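/- Let $\mathbb{K}=\mathbb{R}$ or $\mathbb{K}=\mathbb{C}$, let $n\ge 1$ be an integer, and put $$d=d_{\mathbb{K}}(n)=\begin{cases}\frac{n(n+1)}{2} & \mathbb{K}=\mathbb{R},\\ n^2 & \mathbb{K}=\mathbb{C},\end{cases}\qquad \delta_{\mathbb{K}}(n)=\begin{cases}\frac{2}{n+1}\left(1+\frac{n-1}{2}\sqrt{n+2}\right) & \mathbb{K}=\mathbb{R},\\ \frac1n\left(1+(n-1)\sqrt{n+1}\right) & \mathbb{K}=\mathbb{C}.\end{cases}$$ A maximal equiangular tight frame (maximal ETF) in $\mathbb{K}^n$ is a system of $d$ pairwise different vectors $w_1,\dots,w_d\in\mathbb{K}^n$ of Euclidean norm $1$ such that $|\langle w_i,w_j\rangle|$ has the same value for all $i\neq j$ and such that, for some scalar $\alpha\in\mathbb{K}$, $x=\alpha\sum_{i=1}^d\langle x,w_i\rangle w_i$ for every $x\in\mathbb{K}^n$. For a linear subspace $Y$ of a normed space $V$ over $\mathbb{K}$ let $\lambda(Y,V)=\inf\|P\|$ over all linear projections $P$ of $V$ onto $Y$. For a normed space $X$ over $\mathbb{K}$ let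 $\lambda(X)$ be its absolute projection constant, i.e. the supremum of $\lambda(T(X),V)$ over all normed spaces $V$ over $\mathbb{K}$ and all linear isometric embeddings $T:X\to V$. Let $\lambda_{\mathbb{K}}(n)$ be the supremum of $\lambda(X)$ over all $n$-dimensional normed spaces $X$ over $\mathbb{K}$. Further, write $$\operatorname{absconv}C=\Big\{\sum_{j=1}^N\alpha_jx_j:\ N\in\mathbb{N},\ x_j\in C,\ \alpha_j\in\mathbb{K},\ \sum_{j=1}^N|\alpha_j|\le1\Big\},$$ $$Z(w_1,\dots,w_d)=\Big\{\sum_{i=1}^d a_iw_i:\ a_i\in\mathbb{K},\ |a_i|\le 1\Big\}.$$ Suppose that a maximal ETF exists in $\mathbb{K}^n$. Then $\lambda_{\mathbb{K}}(n)=\delta_{\mathbb{K}}(n)$. Moreover, an $n$-dimensional normed space $X$ over $\mathbb{K}$, with closed dual unit ball $B_{X^*}$, satisfies $\lambda(X)=\lambda_{\mathbb{K}}(n)$ if and only if there exist a maximal ETF $w_1,\dots,w_d$ in $\mathbb{K}^n$ and a linear map $T:X^*\to\mathbb{K}^n$ such that $$\operatorname{absconv}\{w_1,\dots,w_d\}\subseteq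 T(B_{X^*})\subseteq\frac{n}{d\,\delta_{\mathbb{K}}(n)}\,Z(w_1,\dots,w_d).$$ -/

import Mathlib

open scoped ENNReal Pointwise

universe u

noncomputable section

/-- The relative projection constant `λ(Y, Z)`: the infimum of the operator norms of the linear
projections of `Z` onto its subspace `Y` (unbounded projections have infinite norm, so only the
bounded ones matter). It is a value in `[0, ∞]`, and `∞` if there is no bounded projection. -/
def relProjConst {𝕜 : Type} [RCLike 𝕜] {Z : Type u} [NormedAddCommGroup Z] [NormedSpace 𝕜 Z]
    (Y : Submodule 𝕜 Z) : ℝ≥0∞ :=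
  ⨅ (P : Z →L[𝕜] Y) (_ : ∀ y : Y, P (y : Z) = y), ENNReal.ofReal ‖P‖

/-- The absolute projection constant `λ(X)`: the supremum of `λ(T(X), Z)` over all normed spaces
`Z` and all linear isometric embeddings `T : X → Z`. -/
def absProjConst (𝕜 : Type) [RCLike 𝕜] (X : Type u) [NormedAddCommGroup X] [NormedSpace 𝕜 X] :
    ℝ≥0∞ :=
  ⨆ (Z : Type u) (_ : NormedAddCommGroup Z) (_ : NormedSpace 𝕜 Z) (T : X →ₗᵢ[𝕜] Z),
    relProjConst (LinearMap.range T.toLinearMap)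

/-- The maximal absolute projection constant `λ_𝕜(n)`: the supremum of `λ(X)` over all
`n`-dimensional normed spaces `X` over `𝕜`. -/
def maxProjConst (𝕜 : Type) [RCLike 𝕜] (n : ℕ) : ℝ≥0∞ :=
  ⨆ (X : Type u) (_ : NormedAddCommGroup X) (_ : NormedSpace 𝕜 X)
    (_ : FiniteDimensional 𝕜 X) (_ : Module.finrank 𝕜 X = n), absProjConst 𝕜 X

open Classical in
/-- The number `d_𝕜(n)`: `n(n+1)/2` for `𝕜 = ℝ` and `n²` for `𝕜 = ℂ`.
(`RCLike.I` is zero exactly in the real case.) -/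
def gerzonBound (𝕜 : Type) [RCLike 𝕜] (n : ℕ) : ℕ :=
  if (RCLike.I : 𝕜) = 0 then n * (n + 1) / 2 else n ^ 2

open Classical in
/-- The number `δ_𝕜(n)`. -/
def deltaConst (𝕜 : Type) [RCLike 𝕜] (n : ℕ) : ℝ :=
  if (RCLike.I : 𝕜) = 0 then
    2 / ((n : ℝ) + 1) * (1 + ((n : ℝ) - 1) / 2 * Real.sqrt ((n : ℝ) + 2))
  else
    1 / (n : ℝ) * (1 + ((n : ℝ) - 1) * Real.sqrt ((n : ℝ) + 1))

/-- Pairwise different unit vectors for which `|⟨w i, w j⟩|` is the same for all `i ≠ j`. -/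
def IsEquiangular {𝕜 : Type} [RCLike 𝕜] {n N : ℕ} (w : Fin N → EuclideanSpace 𝕜 (Fin n)) : Prop :=
  Function.Injective w ∧ (∀ i, ‖w i‖ = 1) ∧
    ∃ c : ℝ, ∀ i j, i ≠ j → ‖inner 𝕜 (w i) (w j)‖ = c

/-- `x = α ∑ ⟨x, w i⟩ w i` for every `x` (Mathlib's `inner` is linear in its second argument). -/
def IsTightFrame {𝕜 : Type} [RCLike 𝕜] {n N : ℕ} (α : 𝕜)
    (w : Fin N → EuclideanSpace 𝕜 (Fin n)) : Prop :=
  ∀ x : EuclideanSpace 𝕜 (Fin n), x = α • ∑ i, inner 𝕜 (w i) x • w i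

/-- A maximal equiangular tight frame in `𝕜ⁿ`: an equiangular tight frame of `d_𝕜(n)` vectors. -/
def IsMaximalETF {𝕜 : Type} [RCLike 𝕜] {n : ℕ}
    (w : Fin (gerzonBound 𝕜 n) → EuclideanSpace 𝕜 (Fin n)) : Prop :=
  IsEquiangular w ∧ ∃ α : 𝕜, IsTightFrame α w

/-- The absolutely convex hull of a set: all finite sums `∑ a j • x j` with `x j ∈ C` and
`∑ |a j| ≤ 1`. -/
def absConvHull (𝕜 : Type) [RCLike 𝕜] {E : Type u} [AddCommGroup E] [Module 𝕜 E] (C : Set E) :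
    Set E :=
  {y | ∃ (N : ℕ) (x : Fin N → E) (a : Fin N → 𝕜),
    (∀ j, x j ∈ C) ∧ ∑ j, ‖a j‖ ≤ 1 ∧ y = ∑ j, a j • x j}

/-- The zonotope `Z(x₁, …, x_N)`: all sums `∑ a i • x i` with `|a i| ≤ 1` for every `i`. -/
def zonotope (𝕜 : Type) [RCLike 𝕜] {E : Type u} [AddCommGroup E] [Module 𝕜 E] {N : ℕ}
    (x : Fin N → E) : Set E :=
  {y | ∃ a : Fin N → 𝕜, (∀ i, ‖a i‖ ≤ 1) ∧ y = ∑ i, a i • x i}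

end

noncomputable section

open MeasureTheory

/-! Write t for `etfAngle`, d for `gerzonBound`, δ for `deltaConst`. Then δ = (1 + nt)/(1 + t), and
d unit vectors at mutual angle t saturate the Welch bound (`gerzonBound_mul`).

The upper bound λ(X) ≤ δ comes from duality. If the identity of X is not a sum ∑ s_k ⊗ b_k with s_k
in the dual ball and ∑ |η(b_k)| < M for every η in that ball, then Hahn–Banach and Riesz give a
functional F on operators and a probability measure μ on the dual ball with Re F(id) ≥ M and Re F(s
⊗ b) ≤ ∫ |η(b)| dμ (`exists_functional_of_notMem_factorCone`). In coordinates x that make the second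
moments of μ diagonal with entries 0 and 1, averaging F over ξ ⊗ `dualVec` ξ yields Re F(id) ≤ ∫∫
|⟨x, x'⟩|. This double integral is at most δ (`integral_norm_inner_le`): a polynomial inequality
between g = |⟨x, x'⟩| and r = ‖x‖‖x'‖ (`momentGap_nonneg`) is integrated and combined with the known
second moments and with the lower bound for the fourth moment in `fourth_moment_le`.

If λ(X) = δ, all these inequalities are equalities. Then μ is isotropic and sits on d equiangular
lines of mass 1/d each (`exists_representatives`), which gives the frame. Comparing first-order
terms in the domination of F at the points of contact identifies Re F(s ⊗ c) as (δ/n) Re s(c)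
(`re_apply_smulRight_eq`), and the domination then places the dual ball in the stated multiple of
the zonotope.

Conversely, two such inclusions bound every projection of ℓ∞ over the dual ball onto the canonical
copy of X from below by a trace argument (`le_absProjConst`). For a given frame, the norm ∑ |⟨w_i,
y⟩| defines a space to which this applies (`deltaConst_le_maxProjConst`). -/

open Classical in
/-- The common value of `|⟨w i, w j⟩|` in a maximal equiangular tight frame. -/
def etfAngle (𝕜 : Type) [RCLike 𝕜] (n : ℕ) : ℝ :=
  if (RCLike.I : 𝕜) = 0 then (Real.sqrt (n + 2))⁻¹ else (Real.sqrt (n + 1))⁻¹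

/-! ### Arithmetic of the angle, the number of vectors and the extremal constant -/

section Angle

variable (𝕜 : Type) [RCLike 𝕜] {n : ℕ}

lemma etfAngle_pos : 0 < etfAngle 𝕜 n := by
  unfold etfAngle; split_ifs <;> positivity

/-- An equality over ℝ and strict over ℂ. It serves only to exclude measures of deficient rank in
`etfBound_arith`. -/
lemma one_le_mul_etfAngle_sq : 1 ≤ ((n : ℝ) + 2) * etfAngle 𝕜 n ^ 2 := by
  unfold etfAngle; split_ifs
  · rw [inv_pow, Real.sq_sqrt (by positivity)]; field_simp; rfl
  · rw [inv_pow, Real.sq_sqrt (by positivity)]; field_simp; linarith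

lemma mul_etfAngle_sq_lt_one : (n : ℝ) * etfAngle 𝕜 n ^ 2 < 1 := by
  unfold etfAngle; split_ifs
  · rw [inv_pow, Real.sq_sqrt (by positivity)]; field_simp; linarith
  · rw [inv_pow, Real.sq_sqrt (by positivity)]; field_simp; linarith

lemma etfAngle_lt_one (hn : 1 ≤ n) : etfAngle 𝕜 n < 1 := by
  have h1 := mul_etfAngle_sq_lt_one 𝕜 (n := n)
  have h2 := etfAngle_pos 𝕜 (n := n)
  have h3 : (1 : ℝ) ≤ n := by exact_mod_cast hn
  nlinarith [sq_nonneg (etfAngle 𝕜 n)]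

lemma deltaConst_eq (hn : 1 ≤ n) :
    deltaConst 𝕜 n = (1 + n * etfAngle 𝕜 n) / (1 + etfAngle 𝕜 n) := by
  have h3 : (1 : ℝ) ≤ n := by exact_mod_cast hn
  unfold deltaConst etfAngle; split_ifs
  · have hs := Real.sq_sqrt (show (0 : ℝ) ≤ n + 2 by positivity)
    have hp := Real.sqrt_pos.mpr (show (0 : ℝ) < n + 2 by positivity)
    set s := Real.sqrt (n + 2)
    field_simp
    linear_combination ((n : ℝ) - 1) * hs
  · have hs := Real.sq_sqrt (show (0 : ℝ) ≤ n + 1 by positivity)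
    have hp := Real.sqrt_pos.mpr (show (0 : ℝ) < n + 1 by positivity)
    set s := Real.sqrt (n + 1)
    field_simp
    linear_combination ((n : ℝ) - 1) * hs

lemma deltaConst_pos (hn : 1 ≤ n) : 0 < deltaConst 𝕜 n := by
  rw [deltaConst_eq 𝕜 hn]
  have h2 := etfAngle_pos 𝕜 (n := n)
  positivity

/-- This is the Welch relation t² = (d - n)/(n(d - 1)) with denominators cleared: exactly at this
angle can d equiangular unit vectors form a tight frame. -/
lemma gerzonBound_mul :
    (gerzonBound 𝕜 n : ℝ) * (1 - n * etfAngle 𝕜 n ^ 2) = n * (1 - etfAngle 𝕜 n ^ 2) := by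
  unfold gerzonBound etfAngle; split_ifs
  · rw [inv_pow, Real.sq_sqrt (by positivity), Nat.cast_div (Nat.even_mul_succ_self n).two_dvd
      (by norm_num)]
    push_cast
    field_simp
    ring
  · rw [inv_pow, Real.sq_sqrt (by positivity)]
    push_cast
    field_simp
    ring

lemma gerzonBound_pos (hn : 1 ≤ n) : 0 < gerzonBound 𝕜 n := by
  have h := gerzonBound_mul 𝕜 (n := n)
  have h1 := etfAngle_lt_one 𝕜 hn
  have h2 := etfAngle_pos 𝕜 (n := n)
  have h3 : (1 : ℝ) ≤ n := by exact_mod_cast hn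
  rw [Nat.pos_iff_ne_zero]
  intro h0
  rw [h0] at h
  have : 0 < (n : ℝ) * (1 - etfAngle 𝕜 n ^ 2) := by
    apply mul_pos <;> nlinarith
  simp at h
  rcases h with h | h <;> nlinarith

/-- The relation that turns `∑ j, sgn ⟨w j, w i⟩ w j` into a multiple of `w i`. -/
lemma gerzonBound_mul_deltaConst_div (hn : 1 ≤ n) :
    (gerzonBound 𝕜 n : ℝ) * deltaConst 𝕜 n / n =
      (gerzonBound 𝕜 n / n - 1) / etfAngle 𝕜 n + 1 := by
  have h := gerzonBound_mul 𝕜 (n := n)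
  have h1 := etfAngle_lt_one 𝕜 hn
  have h2 := etfAngle_pos 𝕜 (n := n)
  have h3 : (1 : ℝ) ≤ n := by exact_mod_cast hn
  rw [deltaConst_eq 𝕜 hn]
  field_simp
  linear_combination -h

end Angle

/-! ### The pointwise polynomial inequality -/

/-- The gap in the polynomial estimate for `g = |⟨x, y⟩|` and `r = ‖x‖ ‖y‖`. -/
def momentGap (t N r g : ℝ) : ℝ :=
  t ^ 2 * (1 + t) * (r ^ 2 + N ^ 2) + 2 * N * t * (1 + t) * (g ^ 2 / r)
    - 2 * N * t * (1 + t) ^ 2 * g - t ^ 2 * r ^ 2 + (1 + t ^ 2) * g ^ 2 - g ^ 4 / r ^ 2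

/-- Completing the square in N, with c the cosine of the angle. For 0 ≤ c ≤ 1 both summands are
nonnegative. The second vanishes for r > 0 only at c = t or c = 1, and at either value the first
forces r = N. -/
lemma momentGap_mul {t N r c : ℝ} (ht : 0 < t) :
    momentGap t N r (r * c) = t ^ 2 * (1 + t) * (N - r * c * (1 + t - c) / t) ^ 2
      + r ^ 2 * (1 - c) * (c - t) ^ 2 * ((2 + t) * c + t) := by
  unfold momentGap
  field_simp
  ring

lemma momentGap_nonneg {t N r g : ℝ} (ht : 0 < t) (hg : 0 ≤ g) (hgr : g ≤ r) :
    0 ≤ momentGap t N r g := by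
  rcases (hg.trans hgr).eq_or_lt with hr | hr
  · obtain rfl : g = 0 := by linarith
    subst hr
    simp only [momentGap]
    simp
    positivity
  · obtain ⟨c, rfl⟩ : ∃ c, g = r * c := ⟨g / r, by field_simp⟩
    rw [momentGap_mul ht]
    have hc : 0 ≤ c := by by_contra! h; nlinarith
    have hc1 : 0 ≤ 1 - c := by by_contra! h; nlinarith
    positivity

lemma eq_of_momentGap_eq_zero {t N r g : ℝ} (ht : 0 < t) (hN : 0 < N) (hg : 0 ≤ g)
    (hgr : g ≤ r) (h : momentGap t N r g = 0) : r = N ∧ (g = t * N ∨ g = N) := by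
  rcases (hg.trans hgr).eq_or_lt with hr | hr
  · obtain rfl : g = 0 := by linarith
    subst hr
    simp only [momentGap] at h
    simp at h
    rcases h with h | h <;> exfalso
    · rcases h with h | h <;> linarith
    · linarith
  · obtain ⟨c, rfl⟩ : ∃ c, g = r * c := ⟨g / r, by field_simp⟩
    rw [momentGap_mul ht] at h
    have hc : 0 ≤ c := by by_contra! h; nlinarith
    have hc1 : 0 ≤ 1 - c := by by_contra! h; nlinarith
    rw [add_eq_zero_iff_of_nonneg (by positivity) (by positivity)] at h
    obtain ⟨h1, h2⟩ := h
    have h1' : N = r * c * (1 + t - c) / t := by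
      rcases mul_eq_zero.mp h1 with h | h
      · exfalso; have : 0 < t ^ 2 * (1 + t) := by positivity
        linarith
      · have := pow_eq_zero_iff (two_ne_zero) |>.mp h
        linarith
    have h3 : c = 1 ∨ c = t := by
      have : (2 + t) * c + t ≠ 0 := by positivity
      simp only [mul_eq_zero, pow_eq_zero_iff, ne_eq, OfNat.ofNat_ne_zero, not_false_eq_true,
        this, or_false, hr.ne', false_or] at h2
      rcases h2 with h | h
      · left; linarith
      · right; linarith
    rcases h3 with rfl | rfl
    · have : N = r := by rw [h1']; field_simp; ring
      subst this; simp
    · have : N = r := by rw [h1']; field_simp; ring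
      subst this; simp [mul_comm]

/-! ### A lower bound for the fourth moment by invariant tensors -/

section FourthMoment

variable {𝕜 : Type} [RCLike 𝕜] {n : ℕ}

lemma sum_prod_four {ι R : Type*} [Fintype ι] [CommSemiring R] (a b c d : ι → R) :
    ∑ p : ι × ι × ι × ι, a p.1 * b p.2.1 * c p.2.2.1 * d p.2.2.2 =
      (∑ i, a i) * (∑ i, b i) * (∑ i, c i) * ∑ i, d i := by
  simp only [Fintype.sum_prod_type, ← Finset.mul_sum, ← Finset.sum_mul]

/-- The tensor `x ⊗ x̄ ⊗ x̄ ⊗ x`. -/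
def fourTensor (x : EuclideanSpace 𝕜 (Fin n)) :
    EuclideanSpace 𝕜 (Fin n × Fin n × Fin n × Fin n) :=
  WithLp.toLp 2 fun p => x p.1 * star (x p.2.1) * star (x p.2.2.1) * x p.2.2.2

lemma inner_fourTensor (x y : EuclideanSpace 𝕜 (Fin n)) :
    inner 𝕜 (fourTensor x) (fourTensor y) = ((‖inner 𝕜 x y‖ ^ 4 : ℝ) : 𝕜) := by
  have h1 : ((‖inner 𝕜 x y‖ ^ 4 : ℝ) : 𝕜) =
      (inner 𝕜 x y) * star (inner 𝕜 x y) * star (inner 𝕜 x y) * (inner 𝕜 x y) := by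
    have := RCLike.mul_conj (inner 𝕜 x y)
    push_cast
    simp only [RCLike.star_def]
    rw [mul_assoc, mul_comm (starRingEnd 𝕜 (inner 𝕜 x y)) (inner 𝕜 x y), this]
    ring
  rw [h1]
  simp only [PiLp.inner_apply, RCLike.inner_apply, fourTensor, RCLike.star_def, map_mul,
    RCLike.conj_conj, map_sum]
  rw [← sum_prod_four]
  refine Finset.sum_congr rfl fun p _ => ?_
  ring

lemma norm_fourTensor (x : EuclideanSpace 𝕜 (Fin n)) : ‖fourTensor x‖ = ‖x‖ ^ 4 := by
  have h := inner_fourTensor x x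
  rw [inner_self_eq_norm_sq_to_K, inner_self_eq_norm_sq_to_K] at h
  have h' : ‖fourTensor x‖ ^ 2 = (‖x‖ ^ 4) ^ 2 := by
    have : ((‖fourTensor x‖ ^ 2 : ℝ) : 𝕜) = (((‖x‖ ^ 4) ^ 2 : ℝ) : 𝕜) := by
      push_cast
      rw [h]
      simp
      ring
    exact_mod_cast this
  exact (pow_left_inj₀ (norm_nonneg _) (by positivity) two_ne_zero).mp h'

lemma continuous_fourTensor :
    Continuous (fourTensor : EuclideanSpace 𝕜 (Fin n) → _) := by
  refine (PiLp.continuous_toLp 2 _).comp (continuous_pi fun p => ?_)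
  have h : ∀ i, Continuous fun x : EuclideanSpace 𝕜 (Fin n) => x i := fun i => by fun_prop
  exact (((h _).mul (RCLike.continuous_conj.comp (h _))).mul
    (RCLike.continuous_conj.comp (h _))).mul (h _)

/-- The invariant tensor against which `x ⊗ x̄ ⊗ x̄ ⊗ x` is averaged. -/
def isoTensor (κ : 𝕜) : EuclideanSpace 𝕜 (Fin n × Fin n × Fin n × Fin n) :=
  WithLp.toLp 2 fun p => (if p.1 = p.2.1 then if p.2.2.1 = p.2.2.2 then 1 else 0 else 0)
    + (if p.1 = p.2.2.1 then if p.2.1 = p.2.2.2 then 1 else 0 else 0)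
    + κ * (if p.1 = p.2.2.2 then if p.2.1 = p.2.2.1 then 1 else 0 else 0)

lemma inner_isoTensor (κ : ℝ) (T : EuclideanSpace 𝕜 (Fin n × Fin n × Fin n × Fin n)) :
    inner 𝕜 (isoTensor (κ : 𝕜)) T = ∑ i, ∑ j, (T (i, i, j, j) + T (i, j, i, j)
      + κ * T (i, j, j, i)) := by
  simp only [PiLp.inner_apply, RCLike.inner_apply, isoTensor, Fintype.sum_prod_type, map_add,
    apply_ite (starRingEnd 𝕜), map_one, map_zero, RCLike.conj_ofReal, mul_add,
    Finset.sum_add_distrib, mul_ite, mul_one, mul_zero]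
  congr 1
  · congr 1
    · refine Finset.sum_congr rfl fun i _ => ?_
      rw [Finset.sum_eq_single i (by intros; simp_all [eq_comm]) (by simp)]
      simp
    · refine Finset.sum_congr rfl fun i _ => Finset.sum_congr rfl fun j _ => ?_
      rw [Finset.sum_eq_single i (by intros; simp_all [eq_comm]) (by simp)]
      simp
  · refine Finset.sum_congr rfl fun i _ => Finset.sum_congr rfl fun j _ => ?_
    rw [Finset.sum_eq_single j (by intros; simp_all [eq_comm]) (by simp)]
    simp [mul_comm]

lemma normSq_isoTensor (κ : ℝ) :
    ‖(isoTensor (κ : 𝕜) : EuclideanSpace 𝕜 (Fin n × Fin n × Fin n × Fin n))‖ ^ 2 =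
      (2 + κ ^ 2) * n ^ 2 + (2 + 4 * κ) * n := by
  have h := inner_isoTensor κ (isoTensor (κ : 𝕜) :
    EuclideanSpace 𝕜 (Fin n × Fin n × Fin n × Fin n))
  rw [inner_self_eq_norm_sq_to_K] at h
  have : ((‖(isoTensor (κ : 𝕜) : EuclideanSpace 𝕜 (Fin n × Fin n × Fin n × Fin n))‖ ^ 2 : ℝ) : 𝕜)
      = (((2 + κ ^ 2) * n ^ 2 + (2 + 4 * κ) * n : ℝ) : 𝕜) := by
    push_cast
    rw [h]
    simp only [isoTensor]
    have e : ∀ i j : Fin n, (j = i) = (i = j) := fun i j => propext eq_comm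
    simp only [e, Finset.sum_add_distrib, if_true, ← Finset.mul_sum, mul_add]
    have : ∀ i j : Fin n, (if i = j then if i = j then (1 : 𝕜) else 0 else 0)
      = if i = j then 1 else 0 := by intros; split_ifs <;> rfl
    simp [this]
    ring
  exact_mod_cast this

open Classical in
variable (𝕜 n) in
-- Each index pairing contracts x ⊗ x̄ ⊗ x̄ ⊗ x to ‖x‖⁴, except that over ℂ pairing the two
-- unconjugated factors gives |∑ xᵢ²|². Hence three pairings are used over ℝ (s = 3) and two over ℂ
-- (s = 2). The squared norms 3n(n + 2) and 2n(n + 1) account for the two values of t.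
lemma exists_isoTensor : ∃ (U : EuclideanSpace 𝕜 (Fin n × Fin n × Fin n × Fin n)) (s : ℝ),
    0 < s ∧ (∀ x, inner 𝕜 U (fourTensor x) = ((s * ‖x‖ ^ 4 : ℝ) : 𝕜)) ∧
    (1 - ((n : ℝ) - 1) * etfAngle 𝕜 n ^ 2) * ‖U‖ ^ 2 = s ^ 2 * n := by
  have key : ∀ x : EuclideanSpace 𝕜 (Fin n),
      (∑ i, x i * star (x i)) * (∑ i, x i * star (x i)) = ((‖x‖ ^ 4 : ℝ) : 𝕜) := by
    intro x
    have : ∑ i, x i * star (x i) = ((‖x‖ ^ 2 : ℝ) : 𝕜) := by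
      rw [EuclideanSpace.norm_sq_eq]
      push_cast
      exact Finset.sum_congr rfl fun i _ => RCLike.mul_conj _
    rw [this]
    push_cast
    ring
  by_cases hI : (RCLike.I : 𝕜) = 0
  · have hstar : ∀ z : 𝕜, star z = z := fun z =>
      RCLike.conj_eq_iff_im.mpr (RCLike.im_eq_zero hI z)
    refine ⟨isoTensor ((1 : ℝ) : 𝕜), 3, by norm_num, fun x => ?_, ?_⟩
    · rw [inner_isoTensor]
      have h := key x
      rw [Finset.sum_mul_sum] at h
      push_cast at h ⊢
      rw [← h, Finset.mul_sum]
      simp only [Finset.mul_sum]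
      refine Finset.sum_congr rfl fun i _ => Finset.sum_congr rfl fun j _ => ?_
      simp only [fourTensor, hstar]
      ring
    · rw [normSq_isoTensor, etfAngle, if_pos hI, inv_pow, Real.sq_sqrt (by positivity)]
      field_simp
      ring
  · refine ⟨isoTensor ((0 : ℝ) : 𝕜), 2, by norm_num, fun x => ?_, ?_⟩
    · rw [inner_isoTensor]
      have h := key x
      rw [Finset.sum_mul_sum] at h
      push_cast at h ⊢
      rw [← h, Finset.mul_sum]
      simp only [Finset.mul_sum]
      refine Finset.sum_congr rfl fun i _ => Finset.sum_congr rfl fun j _ => ?_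
      simp only [fourTensor]
      ring
    · rw [normSq_isoTensor, etfAngle, if_neg hI, inv_pow, Real.sq_sqrt (by positivity)]
      field_simp
      ring

variable {Ω : Type*} [MeasurableSpace Ω] {μ : Measure Ω} [IsProbabilityMeasure μ]
  {x : Ω → EuclideanSpace 𝕜 (Fin n)} {R : ℝ}

/-- The double integral is ‖∫ L‖² for the normalised tensor L = x ⊗ x̄ ⊗ x̄ ⊗ x / ‖x‖².
Cauchy–Schwarz against the invariant tensor U bounds it below, because ⟨U, L⟩ = s‖x‖² depends on the
length alone. -/
lemma fourth_moment_le (hx : Measurable x) (hR : ∀ ω, ‖x ω‖ ≤ R) :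
    (1 - ((n : ℝ) - 1) * etfAngle 𝕜 n ^ 2) * (∫ ω, ‖x ω‖ ^ 2 ∂μ) ^ 2 ≤
      n * ∫ ω, ∫ ω', ‖inner 𝕜 (x ω) (x ω')‖ ^ 4 / (‖x ω‖ * ‖x ω'‖) ^ 2 ∂μ ∂μ := by
  obtain ⟨U, s, hs, hU, hUs⟩ := exists_isoTensor 𝕜 n
  set L : Ω → EuclideanSpace 𝕜 (Fin n × Fin n × Fin n × Fin n) :=
    fun ω => (((‖x ω‖ ^ 2)⁻¹ : ℝ) : 𝕜) • fourTensor (x ω) with hL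
  have hLn : ∀ ω, ‖L ω‖ = ‖x ω‖ ^ 2 := by
    intro ω
    rw [hL]
    simp only [norm_smul, norm_fourTensor, RCLike.norm_ofReal]
    rw [abs_of_nonneg (by positivity)]
    rcases eq_or_ne ‖x ω‖ 0 with h | h
    · simp [h]
    · field_simp
  have hLi : Integrable L μ := by
    refine Integrable.of_bound (C := R ^ 2) ?_ (Filter.Eventually.of_forall fun ω => ?_)
    · have h1 : AEStronglyMeasurable (fun ω => (((‖x ω‖ ^ 2)⁻¹ : ℝ) : 𝕜)) μ :=
        (RCLike.measurable_ofReal.comp (hx.norm.pow_const 2).inv).aestronglyMeasurable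
      exact h1.smul (continuous_fourTensor.measurable.comp hx).aestronglyMeasurable
    · rw [hLn]
      exact pow_le_pow_left₀ (norm_nonneg _) (hR ω) 2
  have h1 : ∀ ω ω', ((‖inner 𝕜 (x ω) (x ω')‖ ^ 4 / (‖x ω‖ * ‖x ω'‖) ^ 2 : ℝ) : 𝕜) =
      inner 𝕜 (L ω) (L ω') := by
    intro ω ω'
    rw [hL]
    simp only [inner_smul_left, inner_smul_right, inner_fourTensor, RCLike.conj_ofReal]
    rw [← RCLike.ofReal_mul, ← RCLike.ofReal_mul]
    congr 1
    rw [div_eq_mul_inv, mul_pow, mul_inv]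
    ring
  have h2 : ((∫ ω, ∫ ω', ‖inner 𝕜 (x ω) (x ω')‖ ^ 4 / (‖x ω‖ * ‖x ω'‖) ^ 2 ∂μ ∂μ : ℝ) : 𝕜) =
      ((‖∫ ω, L ω ∂μ‖ ^ 2 : ℝ) : 𝕜) := by
    rw [← integral_ofReal]
    simp only [← integral_ofReal, h1, integral_inner hLi]
    have : ∀ ω, inner 𝕜 (L ω) (∫ ω, L ω ∂μ) = starRingEnd 𝕜 (inner 𝕜 (∫ ω, L ω ∂μ) (L ω)) :=
      fun ω => (inner_conj_symm _ _).symm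
    simp only [this]
    rw [integral_conj, integral_inner hLi, inner_self_eq_norm_sq_to_K]
    simp
  have h2' := RCLike.ofReal_injective h2
  have h3 : ∀ ω, inner 𝕜 U (L ω) = ((s * ‖x ω‖ ^ 2 : ℝ) : 𝕜) := by
    intro ω
    rw [hL]
    simp only [inner_smul_right, hU]
    rw [← RCLike.ofReal_mul]
    congr 1
    rcases eq_or_ne ‖x ω‖ 0 with h | h
    · simp [h]
    · field_simp
  have h4 : inner 𝕜 U (∫ ω, L ω ∂μ) = ((s * ∫ ω, ‖x ω‖ ^ 2 ∂μ : ℝ) : 𝕜) := by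
    rw [← integral_inner hLi]
    simp only [h3]
    rw [integral_ofReal, integral_const_mul]
  have h5 := norm_inner_le_norm (𝕜 := 𝕜) U (∫ ω, L ω ∂μ)
  rw [h4, RCLike.norm_ofReal] at h5
  have h6 : (s * ∫ ω, ‖x ω‖ ^ 2 ∂μ) ^ 2 ≤ ‖U‖ ^ 2 * ‖∫ ω, L ω ∂μ‖ ^ 2 := by
    rw [← sq_abs, ← mul_pow]
    exact pow_le_pow_left₀ (abs_nonneg _) h5 2
  have hτ : 0 ≤ 1 - ((n : ℝ) - 1) * etfAngle 𝕜 n ^ 2 := by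
    nlinarith [mul_etfAngle_sq_lt_one 𝕜 (n := n), sq_nonneg (etfAngle 𝕜 n)]
  rw [h2']
  have h7 := mul_le_mul_of_nonneg_left h6 hτ
  have h8 : s ^ 2 * ((1 - ((n : ℝ) - 1) * etfAngle 𝕜 n ^ 2) * (∫ ω, ‖x ω‖ ^ 2 ∂μ) ^ 2) ≤
      s ^ 2 * (n * ‖∫ ω, L ω ∂μ‖ ^ 2) := by
    calc _ = (1 - ((n : ℝ) - 1) * etfAngle 𝕜 n ^ 2) * (s * ∫ ω, ‖x ω‖ ^ 2 ∂μ) ^ 2 := by ring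
      _ ≤ _ := h7
      _ = _ := by rw [← mul_assoc, hUs]; ring
  exact le_of_mul_le_mul_left h8 (by positivity)

end FourthMoment

/-! ### The first absolute moment of an isotropic measure -/

section KeyInequality

variable {𝕜 : Type} [RCLike 𝕜] {n : ℕ}

/-- The scalar part of the key estimate: m is the rank, a = ∫∫ g²/r, γ = ∫∫ g, κ = ∫∫ g⁴/r², and J
is the integral of `momentGap`. A multiple of δ - γ is a sum of nonnegative terms, so equality kills
each of them. -/
lemma etfBound_arith {t N m a γ κ J : ℝ} (ht : 0 < t) (hN : 0 < N) (ha : a ≤ 1)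
    (hκ : (1 - (N - 1) * t ^ 2) * m ^ 2 ≤ N * κ) (hJ : 0 ≤ J)
    (hJeq : J = t ^ 2 * (1 + t) * (m ^ 2 + N ^ 2) + 2 * N * t * (1 + t) * a
      - 2 * N * t * (1 + t) ^ 2 * γ - t ^ 2 * m ^ 2 + (1 + t ^ 2) * m - κ)
    (hm : m = N ∨ 0 ≤ m ∧ m ≤ N - 1 ∧ 1 ≤ (N + 2) * t ^ 2) :
    γ ≤ (1 + N * t) / (1 + t) ∧ ((1 + N * t) / (1 + t) ≤ γ → m = N ∧ J = 0) := by
  set δ := (1 + N * t) / (1 + t) with hδ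
  have hδ' : δ * (1 + t) = 1 + N * t := by rw [hδ]; field_simp
  have hK : 0 ≤ (N - m) * (N * t ^ 2 * (1 + t) * (N + m) - m * (1 + t ^ 2)) ∧
      (m ≠ N → 0 < (N - m) * (N * t ^ 2 * (1 + t) * (N + m) - m * (1 + t ^ 2))) := by
    rcases hm with rfl | ⟨h0, h1, h2⟩
    · simp
    · have h3 : 0 < N * t ^ 2 * (1 + t) * (N + m) - m * (1 + t ^ 2) := by
        have h4 : 0 < (N ^ 2 + N * m - m) * t ^ 2 - m := by
          have h6 : 0 ≤ N ^ 2 + N * m - m := by nlinarith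
          have h7 : (N ^ 2 + N * m - m) ≤ (N + 2) * ((N ^ 2 + N * m - m) * t ^ 2) := by nlinarith
          -- This says 3m < N². As m ≤ N - 1, it follows from 4(N² - 3N + 3) = (2N - 3)² + 3 > 0.
          have h8 : (N + 2) * m < N ^ 2 + N * m - m := by nlinarith [sq_nonneg (2 * N - 3)]
          by_contra! h9
          nlinarith
        have h5 : 0 < N * t ^ 2 * t * (N + m) := by positivity
        nlinarith
      have h4 : 0 < (N - m) * (N * t ^ 2 * (1 + t) * (N + m) - m * (1 + t ^ 2)) :=
        mul_pos (by linarith) h3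
      exact ⟨h4.le, fun _ => h4⟩
  obtain ⟨hK0, hK1⟩ := hK
  have main : 2 * N ^ 2 * t * (1 + t) ^ 2 * (δ - γ) = 2 * N ^ 2 * t * (1 + t) * (1 - a) + N * J
      + (N * κ - (1 - (N - 1) * t ^ 2) * m ^ 2)
      + (N - m) * (N * t ^ 2 * (1 + t) * (N + m) - m * (1 + t ^ 2)) := by
    rw [hJeq]
    linear_combination 2 * N ^ 2 * t * (1 + t) * hδ'
  have hc : 0 < 2 * N ^ 2 * t * (1 + t) ^ 2 := by positivity
  have ha' : 0 ≤ 2 * N ^ 2 * t * (1 + t) * (1 - a) :=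
    mul_nonneg (by positivity) (by linarith)
  have hNJ : 0 ≤ N * J := by positivity
  refine ⟨?_, fun h => ?_⟩
  · by_contra! h
    nlinarith
  · have h0 : 2 * N ^ 2 * t * (1 + t) ^ 2 * (δ - γ) ≤ 0 :=
      mul_nonpos_of_nonneg_of_nonpos hc.le (by linarith)
    refine ⟨by_contra fun hne => ?_, ?_⟩
    · have := hK1 hne
      linarith
    · have : N * J = 0 := by linarith
      simpa [hN.ne'] using this

variable {Ω : Type*} [MeasurableSpace Ω] {μ : Measure Ω} [IsProbabilityMeasure μ]
  {x : Ω → EuclideanSpace 𝕜 (Fin n)} {R : ℝ} {ε : Fin n → ℝ}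

/-- The first absolute moment of an isotropic measure is at most `δ`, and in the case of equality
almost all pairs of points are equally long and either parallel or at the angle of a maximal
equiangular tight frame. -/
theorem integral_norm_inner_le (hn : 1 ≤ n) (hx : Measurable x) (hR : ∀ ω, ‖x ω‖ ≤ R)
    (hε : ∀ i, ε i = 0 ∨ ε i = 1)
    (hiso : ∀ y, ∫ ω, ‖inner 𝕜 (x ω) y‖ ^ 2 ∂μ = ∑ i, ε i * ‖y i‖ ^ 2) :
    ∫ ω, ∫ ω', ‖inner 𝕜 (x ω) (x ω')‖ ∂μ ∂μ ≤ deltaConst 𝕜 n ∧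
    (deltaConst 𝕜 n ≤ ∫ ω, ∫ ω', ‖inner 𝕜 (x ω) (x ω')‖ ∂μ ∂μ →
      (∀ i, ε i = 1) ∧ ∀ᵐ p ∂(μ.prod μ), ‖x p.1‖ * ‖x p.2‖ = n ∧
        (‖inner 𝕜 (x p.1) (x p.2)‖ = etfAngle 𝕜 n * n ∨
          ‖inner 𝕜 (x p.1) (x p.2)‖ = n)) := by
  have ht := etfAngle_pos 𝕜 (n := n)
  have hN : (0 : ℝ) < n := by exact_mod_cast hn
  set t := etfAngle 𝕜 n with ht_def
  set r : Ω × Ω → ℝ := fun p => ‖x p.1‖ * ‖x p.2‖ with hr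
  set g : Ω × Ω → ℝ := fun p => ‖inner 𝕜 (x p.1) (x p.2)‖ with hg
  have hR0 : 0 ≤ R := by
    obtain ⟨ω⟩ : Nonempty Ω := μ.nonempty_of_neZero
    exact (norm_nonneg _).trans (hR ω)
  have hx1 : Measurable fun p : Ω × Ω => x p.1 := hx.comp measurable_fst
  have hx2 : Measurable fun p : Ω × Ω => x p.2 := hx.comp measurable_snd
  have hrm : Measurable r := hx1.norm.mul hx2.norm
  have hgm : Measurable g := (hx1.inner hx2).norm
  have hr0 : ∀ p, 0 ≤ r p := fun p => by positivity
  have hg0 : ∀ p, 0 ≤ g p := fun p => norm_nonneg _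
  have hgr : ∀ p, g p ≤ r p := fun p => norm_inner_le_norm _ _
  have hrR : ∀ p, r p ≤ R ^ 2 := fun p => by
    rw [sq]; exact mul_le_mul (hR _) (hR _) (norm_nonneg _) hR0
  have hbd : ∀ f : Ω × Ω → ℝ, Measurable f → ∀ k : ℕ, (∀ p, 0 ≤ f p) → (∀ p, f p ≤ r p ^ k) →
      Integrable f (μ.prod μ) := by
    intro f hf k h0 h1
    refine Integrable.of_bound (C := (R ^ 2) ^ k) hf.aestronglyMeasurable
      (Filter.Eventually.of_forall fun p => ?_)
    rw [Real.norm_of_nonneg (h0 p)]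
    exact (h1 p).trans (pow_le_pow_left₀ (hr0 p) (hrR p) k)
  have i1 : Integrable (fun p => r p ^ 2) (μ.prod μ) :=
    hbd _ (hrm.pow_const 2) 2 (fun p => by positivity) (fun p => le_rfl)
  have i2 : Integrable g (μ.prod μ) :=
    hbd _ hgm 1 hg0 (fun p => by rw [pow_one]; exact hgr p)
  have i3 : Integrable (fun p => g p ^ 2) (μ.prod μ) :=
    hbd _ (hgm.pow_const 2) 2 (fun p => by positivity) (fun p => pow_le_pow_left₀ (hg0 p) (hgr p) 2)
  have i4 : Integrable (fun p => g p ^ 2 / r p) (μ.prod μ) := by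
    refine hbd _ ((hgm.pow_const 2).div hrm) 1 (fun p => div_nonneg (sq_nonneg _) (hr0 p))
      (fun p => div_le_of_le_mul₀ (hr0 p) (by simpa using hr0 p) ?_)
    nlinarith [hg0 p, hgr p, hr0 p]
  have i5 : Integrable (fun p => g p ^ 4 / r p ^ 2) (μ.prod μ) := by
    refine hbd _ ((hgm.pow_const 4).div (hrm.pow_const 2)) 2
      (fun p => div_nonneg (by positivity) (by positivity))
      (fun p => div_le_of_le_mul₀ (by positivity) (by positivity) ?_)
    calc g p ^ 4 ≤ r p ^ 4 := pow_le_pow_left₀ (hg0 p) (hgr p) 4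
      _ = _ := by ring
  have ix : ∀ f : Ω → ℝ, Measurable f → (∀ ω, 0 ≤ f ω) → (∀ ω, f ω ≤ R ^ 2) →
      Integrable f μ := by
    intro f hf h0 h1
    refine Integrable.of_bound (C := R ^ 2) hf.aestronglyMeasurable
      (Filter.Eventually.of_forall fun p => ?_)
    rw [Real.norm_of_nonneg (h0 p)]
    exact h1 p
  set m := ∑ i, ε i with hm
  have hcoord : ∀ i, ∫ ω, ‖x ω i‖ ^ 2 ∂μ = ε i := by
    intro i
    have := hiso (EuclideanSpace.single i 1)
    simpa [EuclideanSpace.inner_single_right, Finset.sum_ite_eq, apply_ite] using this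
  have hle : ∀ ω i, ‖x ω i‖ ^ 2 ≤ R ^ 2 := fun ω i =>
    pow_le_pow_left₀ (norm_nonneg _) ((PiLp.norm_apply_le (x ω) i).trans (hR ω)) 2
  have hcm : ∀ i, Measurable fun ω => x ω i := fun i =>
    (EuclideanSpace.proj (𝕜 := 𝕜) i).continuous.measurable.comp hx
  have icoord : ∀ i, Integrable (fun ω => ‖x ω i‖ ^ 2) μ := fun i =>
    ix _ ((hcm i).norm.pow_const 2) (fun ω => by positivity) (fun ω => hle ω i)
  have hnorm : ∫ ω, ‖x ω‖ ^ 2 ∂μ = m := by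
    simp_rw [EuclideanSpace.norm_sq_eq]
    rw [integral_finsetSum _ fun i _ => icoord i]
    simp [hcoord, hm]
  have v1 : ∫ p, r p ^ 2 ∂(μ.prod μ) = m ^ 2 := by
    simp only [hr, mul_pow]
    rw [integral_prod_mul (fun ω => ‖x ω‖ ^ 2) (fun ω => ‖x ω‖ ^ 2), hnorm]
    ring
  have v2 : ∫ p, g p ∂(μ.prod μ) = ∫ ω, ∫ ω', ‖inner 𝕜 (x ω) (x ω')‖ ∂μ ∂μ := integral_prod _ i2
  -- The inner integral is ∑ εᵢ |xᵢ|², so the double one is ∑ εᵢ², which equals ∑ εᵢ since εᵢ is 0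
  -- or 1.
  have v3 : ∫ p, g p ^ 2 ∂(μ.prod μ) = m := by
    rw [integral_prod _ i3]
    simp only [hg]
    have : ∀ ω, ∫ ω', ‖inner 𝕜 (x ω) (x ω')‖ ^ 2 ∂μ = ∑ i, ε i * ‖x ω i‖ ^ 2 := by
      intro ω
      rw [← hiso (x ω)]
      simp_rw [norm_inner_symm (x ω)]
    simp_rw [this]
    rw [integral_finsetSum _ fun i _ => (icoord i).const_mul _]
    simp only [integral_const_mul, hcoord, hm]
    refine Finset.sum_congr rfl fun i _ => ?_
    rcases hε i with h | h <;> simp [h]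
  have v5 : (1 - ((n : ℝ) - 1) * t ^ 2) * m ^ 2 ≤ n * ∫ p, g p ^ 4 / r p ^ 2 ∂(μ.prod μ) := by
    rw [integral_prod _ i5, ← hnorm]
    exact fourth_moment_le hx hR
  -- By AM–GM, 1/(‖x‖‖x'‖) is at most the mean of 1/‖x‖² and 1/‖x'‖². After either choice, isotropy
  -- bounds the integral over the other variable by 1.
  have v4 : ∫ p, g p ^ 2 / r p ∂(μ.prod μ) ≤ 1 := by
    have hquot : ∀ ω ω', ‖inner 𝕜 (x ω) (x ω')‖ ^ 2 / ‖x ω‖ ^ 2 ≤ ‖x ω'‖ ^ 2 := fun ω ω' =>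
      div_le_of_le_mul₀ (by positivity) (by positivity) (by
        rw [← mul_pow, mul_comm]
        exact pow_le_pow_left₀ (norm_nonneg _) (norm_inner_le_norm _ _) 2)
    have hqm : Measurable fun p : Ω × Ω => g p ^ 2 / ‖x p.1‖ ^ 2 :=
      (hgm.pow_const 2).div (hx1.norm.pow_const 2)
    have hqm' : Measurable fun p : Ω × Ω => g p ^ 2 / ‖x p.2‖ ^ 2 :=
      (hgm.pow_const 2).div (hx2.norm.pow_const 2)
    have j1 : Integrable (fun p : Ω × Ω => g p ^ 2 / ‖x p.1‖ ^ 2) (μ.prod μ) := by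
      refine Integrable.of_bound (C := R ^ 2) hqm.aestronglyMeasurable
        (Filter.Eventually.of_forall fun p => ?_)
      rw [Real.norm_of_nonneg (by positivity)]
      exact (hquot _ _).trans (pow_le_pow_left₀ (norm_nonneg _) (hR _) 2)
    have j2 : Integrable (fun p : Ω × Ω => g p ^ 2 / ‖x p.2‖ ^ 2) (μ.prod μ) := by
      refine Integrable.of_bound (C := R ^ 2) hqm'.aestronglyMeasurable
        (Filter.Eventually.of_forall fun p => ?_)
      rw [Real.norm_of_nonneg (by positivity)]
      simp only [hg]
      rw [norm_inner_symm]
      exact (hquot _ _).trans (pow_le_pow_left₀ (norm_nonneg _) (hR _) 2)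
    have hone : ∀ ω, ∫ ω', ‖inner 𝕜 (x ω) (x ω')‖ ^ 2 / ‖x ω‖ ^ 2 ∂μ ≤ 1 := by
      intro ω
      rw [integral_div]
      simp_rw [norm_inner_symm (x ω)]
      rw [hiso, EuclideanSpace.norm_sq_eq]
      refine div_le_one_of_le₀ (Finset.sum_le_sum fun i _ => ?_)
        (Finset.sum_nonneg fun i _ => by positivity)
      rcases hε i with h | h <;> simp [h]
    have w1 : ∫ p, g p ^ 2 / ‖x p.1‖ ^ 2 ∂(μ.prod μ) ≤ 1 := by
      rw [integral_prod _ j1]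
      calc _ ≤ ∫ ω, (1 : ℝ) ∂μ := integral_mono j1.integral_prod_left (integrable_const _) hone
        _ = 1 := by simp
    have w2 : ∫ p, g p ^ 2 / ‖x p.2‖ ^ 2 ∂(μ.prod μ) ≤ 1 := by
      rw [integral_prod_symm _ j2]
      have hone' : ∀ ω, ∫ ω', g (ω', ω) ^ 2 / ‖x ω‖ ^ 2 ∂μ ≤ 1 := by
        intro ω
        simp only [hg]
        simp_rw [fun ω' => norm_inner_symm (𝕜 := 𝕜) (x ω') (x ω)]
        exact hone ω
      calc _ ≤ ∫ ω, (1 : ℝ) ∂μ := integral_mono j2.integral_prod_right (integrable_const _) hone'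
        _ = 1 := by simp
    calc ∫ p, g p ^ 2 / r p ∂(μ.prod μ)
        ≤ ∫ p, (2⁻¹ * (g p ^ 2 / ‖x p.1‖ ^ 2) + 2⁻¹ * (g p ^ 2 / ‖x p.2‖ ^ 2)) ∂(μ.prod μ) := by
          refine integral_mono i4 ((j1.const_mul _).add (j2.const_mul _)) fun p => ?_
          simp only [div_eq_mul_inv, hr, mul_inv]
          nlinarith [mul_nonneg (sq_nonneg (g p)) (sq_nonneg (‖x p.1‖⁻¹ - ‖x p.2‖⁻¹)),
            inv_pow ‖x p.1‖ 2, inv_pow ‖x p.2‖ 2]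
      _ = 2⁻¹ * ∫ p, g p ^ 2 / ‖x p.1‖ ^ 2 ∂(μ.prod μ)
          + 2⁻¹ * ∫ p, g p ^ 2 / ‖x p.2‖ ^ 2 ∂(μ.prod μ) := by
          rw [integral_add (j1.const_mul _) (j2.const_mul _), integral_const_mul,
            integral_const_mul]
      _ ≤ 1 := by linarith
  have hgap : ∀ p, momentGap t n (r p) (g p) = t ^ 2 * (1 + t) * n ^ 2 +
      ((t ^ 2 * (1 + t) - t ^ 2) * r p ^ 2 + (2 * n * t * (1 + t) * (g p ^ 2 / r p) +
      (-(2 * n * t * (1 + t) ^ 2) * g p + ((1 + t ^ 2) * g p ^ 2 +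
        (-1) * (g p ^ 4 / r p ^ 2))))) := by
    intro p
    unfold momentGap
    ring
  have k5 := i5.const_mul (-1)
  have k4 := (i3.const_mul (1 + t ^ 2)).add k5
  have k3 := (i2.const_mul (-(2 * n * t * (1 + t) ^ 2))).add k4
  have k2 := (i4.const_mul (2 * n * t * (1 + t))).add k3
  have k1 := (i1.const_mul (t ^ 2 * (1 + t) - t ^ 2)).add k2
  have k0 := (integrable_const (μ := μ.prod μ) (t ^ 2 * (1 + t) * (n : ℝ) ^ 2)).add k1
  have hJint : Integrable (fun p => momentGap t n (r p) (g p)) (μ.prod μ) :=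
    k0.congr (Filter.Eventually.of_forall fun p => (hgap p).symm)
  have hJeq : ∫ p, momentGap t n (r p) (g p) ∂(μ.prod μ) =
      t ^ 2 * (1 + t) * (m ^ 2 + (n : ℝ) ^ 2)
      + 2 * n * t * (1 + t) * ∫ p, g p ^ 2 / r p ∂(μ.prod μ)
      - 2 * n * t * (1 + t) ^ 2 * ∫ ω, ∫ ω', ‖inner 𝕜 (x ω) (x ω')‖ ∂μ ∂μ
      - t ^ 2 * m ^ 2 + (1 + t ^ 2) * m - ∫ p, g p ^ 4 / r p ^ 2 ∂(μ.prod μ) := by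
    calc _ = t ^ 2 * (1 + t) * (n : ℝ) ^ 2 + ((t ^ 2 * (1 + t) - t ^ 2) * ∫ p, r p ^ 2 ∂(μ.prod μ) +
          (2 * n * t * (1 + t) * ∫ p, g p ^ 2 / r p ∂(μ.prod μ) +
          (-(2 * n * t * (1 + t) ^ 2) * ∫ p, g p ∂(μ.prod μ) +
          ((1 + t ^ 2) * ∫ p, g p ^ 2 ∂(μ.prod μ) +
            (-1) * ∫ p, g p ^ 4 / r p ^ 2 ∂(μ.prod μ))))) := by
          simp_rw [← integral_const_mul]
          rw [← integral_add' (i3.const_mul _) k5, ← integral_add' (i2.const_mul _) k4,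
            ← integral_add' (i4.const_mul _) k3, ← integral_add' (i1.const_mul _) k2]
          have := integral_add (integrable_const (μ := μ.prod μ) (t ^ 2 * (1 + t) * (n : ℝ) ^ 2)) k1
          simp only [integral_const, probReal_univ, one_smul] at this
          simp_rw [hgap]
          exact this
      _ = _ := by rw [v1, v2, v3]; ring
  have hgap0 : ∀ p, 0 ≤ momentGap t n (r p) (g p) := fun p =>
    momentGap_nonneg ht (hg0 p) (hgr p)
  -- The rank is an integer, so a deficient one is at most n - 1. This gap makes the estimate strict
  -- below full rank.
  have hm' : m = n ∨ 0 ≤ m ∧ m ≤ n - 1 ∧ 1 ≤ ((n : ℝ) + 2) * t ^ 2 := by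
    by_cases h : ∀ i, ε i = 1
    · left; simp [hm, h]
    · right
      push Not at h
      obtain ⟨i, hi⟩ := h
      refine ⟨Finset.sum_nonneg fun i _ => ?_, ?_, one_le_mul_etfAngle_sq 𝕜⟩
      · rcases hε i with h | h <;> simp [h]
      · have h1 : m = ∑ j ∈ Finset.univ.erase i, ε j := by
          rw [hm, ← Finset.add_sum_erase _ _ (Finset.mem_univ i), (hε i).resolve_right hi, zero_add]
        rw [h1]
        calc _ ≤ ∑ j ∈ Finset.univ.erase i, (1 : ℝ) := Finset.sum_le_sum fun j _ => by
              rcases hε j with h | h <;> simp [h]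
          _ = n - 1 := by simp [Finset.card_erase_of_mem, Nat.cast_sub hn]
  obtain ⟨h1, h2⟩ := etfBound_arith ht hN v4 v5 (integral_nonneg hgap0) hJeq hm'
  rw [deltaConst_eq 𝕜 hn]
  refine ⟨h1, fun h => ?_⟩
  obtain ⟨h3, h4⟩ := h2 h
  constructor
  · by_contra hne
    push Not at hne
    obtain ⟨i, hi⟩ := hne
    have : m < ∑ _i : Fin n, (1 : ℝ) := Finset.sum_lt_sum (fun j _ => by
      rcases hε j with h | h <;> simp [h]) ⟨i, Finset.mem_univ _, by
      simp [(hε i).resolve_right hi]⟩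
    simp at this
    linarith
  · rw [integral_eq_zero_iff_of_nonneg hgap0 hJint] at h4
    filter_upwards [h4] with p hp
    exact eq_of_momentGap_eq_zero ht hN (hg0 p) (hgr p) hp

end KeyInequality

/-! ### Duality: from failed factorizations to a functional and a measure -/

section Separation

variable (𝕜 : Type) [RCLike 𝕜] (X : Type u) [NormedAddCommGroup X] [NormedSpace 𝕜 X]

/-- The closed unit ball of the dual space, as a type. -/
abbrev DualBall : Type u := Metric.closedBall (0 : StrongDual 𝕜 X) 1

variable {𝕜 X}

lemma DualBall.norm_le (s : DualBall 𝕜 X) : ‖(s : StrongDual 𝕜 X)‖ ≤ 1 :=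
  mem_closedBall_zero_iff.mp s.2

lemma DualBall.continuous_apply (b : X) :
    Continuous fun η : DualBall 𝕜 X => (η : StrongDual 𝕜 X) b :=
  ((ContinuousLinearMap.apply 𝕜 𝕜 b).continuous).comp continuous_subtype_val

instance : Nonempty (DualBall 𝕜 X) := ⟨⟨0, by simp⟩⟩

instance [FiniteDimensional 𝕜 X] : CompactSpace (DualBall 𝕜 X) := by
  have : ProperSpace (StrongDual 𝕜 X) := FiniteDimensional.proper 𝕜 _
  exact isCompact_iff_compactSpace.mp (isCompact_closedBall _ _)

variable (𝕜 X) in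
/-- The pairs `(∑ s k ⊗ b k, f)` with `s k` in the dual ball and `f > ∑ |⟨·, b k⟩|` on it. -/
def factorCone : Set ((X →L[𝕜] X) × C(DualBall 𝕜 X, ℝ)) :=
  {p | ∃ (ι : Type) (_ : Fintype ι) (s : ι → DualBall 𝕜 X) (b : ι → X),
    p.1 = ∑ k, (s k : StrongDual 𝕜 X).smulRight (b k) ∧
      ∀ η : DualBall 𝕜 X, ∑ k, ‖(η : StrongDual 𝕜 X) (b k)‖ < p.2 η}

lemma factorCone_add {p q : (X →L[𝕜] X) × C(DualBall 𝕜 X, ℝ)} (hp : p ∈ factorCone 𝕜 X)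
    (hq : q ∈ factorCone 𝕜 X) : p + q ∈ factorCone 𝕜 X := by
  obtain ⟨ι, _, s, b, h1, h2⟩ := hp
  obtain ⟨κ, _, s', b', h1', h2'⟩ := hq
  refine ⟨ι ⊕ κ, inferInstance, Sum.elim s s', Sum.elim b b', ?_, fun η => ?_⟩
  · simp [h1, h1']
  · simpa using add_lt_add (h2 η) (h2' η)

lemma factorCone_smul {v : X →L[𝕜] X} {f : C(DualBall 𝕜 X, ℝ)} (hp : (v, f) ∈ factorCone 𝕜 X)
    {c : ℝ} (hc : 0 < c) : ((c : 𝕜) • v, c • f) ∈ factorCone 𝕜 X := by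
  obtain ⟨ι, _, s, b, h1, h2⟩ := hp
  refine ⟨ι, inferInstance, s, fun k => (c : 𝕜) • b k, ?_, fun η => ?_⟩
  · simp only at h1
    simp only [h1, Finset.smul_sum]
    refine Finset.sum_congr rfl fun k _ => ?_
    ext y
    exact smul_comm _ _ _
  · simp only [map_smul, norm_smul, RCLike.norm_ofReal, abs_of_pos hc, ← Finset.mul_sum]
    simpa using mul_lt_mul_of_pos_left (h2 η) hc

lemma mem_factorCone_of_pos {f : C(DualBall 𝕜 X, ℝ)} (hf : ∀ η, 0 < f η) :
    ((0 : X →L[𝕜] X), f) ∈ factorCone 𝕜 X :=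
  ⟨Empty, inferInstance, Empty.elim, Empty.elim, by simp, by simpa using hf⟩

lemma mem_factorCone_single (s : DualBall 𝕜 X) (b : X) {f : C(DualBall 𝕜 X, ℝ)}
    (hf : ∀ η : DualBall 𝕜 X, ‖(η : StrongDual 𝕜 X) b‖ < f η) :
    ((s : StrongDual 𝕜 X).smulRight b, f) ∈ factorCone 𝕜 X :=
  ⟨Unit, inferInstance, fun _ => s, fun _ => b, by simp, by simpa using hf⟩

/-- Every operator on a finite-dimensional space is a sum of rank-one operators whose total size is
controlled by its norm. -/
lemma exists_forall_mem_factorCone [FiniteDimensional 𝕜 X] :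
    ∃ K : ℝ, 0 < K ∧ ∀ (v : X →L[𝕜] X) (f : C(DualBall 𝕜 X, ℝ)), (∀ η, K * ‖v‖ < f η) →
      (v, f) ∈ factorCone 𝕜 X := by
  let e := Module.finBasis 𝕜 X
  let c : Fin (Module.finrank 𝕜 X) → StrongDual 𝕜 X := fun j => (e.coord j).toContinuousLinearMap
  have hc : ∀ j y, c j y = e.repr y j := fun j y => rfl
  have hpos : ∀ j, 0 < 1 + ‖c j‖ := fun j => by positivity
  refine ⟨1 + ∑ j, (1 + ‖c j‖) * ‖e j‖, by positivity, fun v f hf => ?_⟩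
  -- Expansion in a basis. The scalar 1 + ‖c j‖ is shifted from the functional to the vector to
  -- bring the functional into the ball; the summand 1 keeps it nonzero.
  refine ⟨Fin (Module.finrank 𝕜 X), inferInstance,
    fun j => ⟨(((1 + ‖c j‖)⁻¹ : ℝ) : 𝕜) • c j, ?_⟩,
    fun j => ((1 + ‖c j‖ : ℝ) : 𝕜) • v (e j), ?_, fun η => ?_⟩
  · rw [mem_closedBall_zero_iff, norm_smul, RCLike.norm_ofReal, abs_of_pos (inv_pos.mpr (hpos j)),
      inv_mul_le_iff₀ (hpos j)]
    linarith
  · ext y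
    conv_lhs => rw [← e.sum_repr y]
    simp only [map_sum, map_smul, sum_apply,
      ContinuousLinearMap.smulRight_apply, smul_apply, hc, smul_smul,
      smul_eq_mul]
    refine Finset.sum_congr rfl fun j _ => ?_
    have : (((1 + ‖c j‖ : ℝ)) : 𝕜) ≠ 0 := by exact_mod_cast (hpos j).ne'
    congr 1
    push_cast at this ⊢
    field_simp
  · refine lt_of_le_of_lt ?_ (hf η)
    calc ∑ j, ‖(η : StrongDual 𝕜 X) (((1 + ‖c j‖ : ℝ) : 𝕜) • v (e j))‖
        ≤ ∑ j, (1 + ‖c j‖) * ‖e j‖ * ‖v‖ := by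
          refine Finset.sum_le_sum fun j _ => ?_
          rw [map_smul, norm_smul, RCLike.norm_ofReal, abs_of_pos (hpos j), mul_assoc]
          refine mul_le_mul_of_nonneg_left ?_ (hpos j).le
          calc ‖(η : StrongDual 𝕜 X) (v (e j))‖ ≤ 1 * ‖v (e j)‖ :=
                (η : StrongDual 𝕜 X).le_of_opNorm_le η.norm_le _
            _ ≤ ‖e j‖ * ‖v‖ := by rw [one_mul, mul_comm]; exact v.le_opNorm _
      _ = (∑ j, (1 + ‖c j‖) * ‖e j‖) * ‖v‖ := by rw [Finset.sum_mul]
      _ ≤ _ := by gcongr; linarith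

lemma exists_pos_le_of_pos [FiniteDimensional 𝕜 X] {h : DualBall 𝕜 X → ℝ} (hc : Continuous h)
    (hpos : ∀ η, 0 < h η) : ∃ ε > 0, ∀ η, ε ≤ h η := by
  obtain ⟨η, hη⟩ := hc.exists_forall_le_of_hasCompactMulSupport (by
    exact HasCompactMulSupport.of_compactSpace h)
  exact ⟨h η, hpos η, hη⟩

/-- Compactness of the dual ball turns the strict inequality into a uniform slack ε. A nearby pair
is then (v, f - ε/2) plus a pair whose operator is small enough to be absorbed by the remaining ε/2.
-/
lemma isOpen_factorCone [FiniteDimensional 𝕜 X] : IsOpen (factorCone 𝕜 X) := by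
  obtain ⟨K, hK, hKm⟩ := exists_forall_mem_factorCone (𝕜 := 𝕜) (X := X)
  rw [Metric.isOpen_iff]
  rintro ⟨v, f⟩ ⟨ι, _, s, b, h1, h2⟩
  simp only at h1 h2
  obtain ⟨ε, hε, hle⟩ := exists_pos_le_of_pos (𝕜 := 𝕜) (X := X)
    (h := fun η => f η - ∑ k, ‖(η : StrongDual 𝕜 X) (b k)‖)
    (f.continuous.sub (continuous_finsetSum _ fun k _ => (DualBall.continuous_apply (b k)).norm))
    (fun η => sub_pos.mpr (h2 η))
  refine ⟨min (ε / 4) (ε / (4 * K)), by positivity, ?_⟩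
  rintro ⟨v', f'⟩ hmem
  rw [mem_ball_iff_norm, Prod.norm_def, max_lt_iff] at hmem
  simp only [Prod.mk_sub_mk] at hmem
  have hv : K * ‖v' - v‖ < ε / 4 := by
    have := hmem.1.trans_le (min_le_right _ _)
    rw [lt_div_iff₀ (by positivity)] at this
    linarith
  have hf : ∀ η, |f' η - f η| < ε / 4 := fun η =>
    (ContinuousMap.norm_coe_le_norm (f' - f) η).trans_lt (hmem.2.trans_le (min_le_left _ _))
  have m1 : (v, f - ContinuousMap.const _ (ε / 2)) ∈ factorCone 𝕜 X := by
    refine ⟨ι, inferInstance, s, b, h1, fun η => ?_⟩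
    have := hle η
    simp only [ContinuousMap.sub_apply, ContinuousMap.const_apply]
    linarith
  have m2 : (v' - v, f' - f + ContinuousMap.const _ (ε / 2)) ∈ factorCone 𝕜 X := by
    refine hKm _ _ fun η => ?_
    have := abs_lt.mp (hf η)
    simp only [ContinuousMap.add_apply, ContinuousMap.sub_apply, ContinuousMap.const_apply]
    linarith
  have := factorCone_add m1 m2
  simpa using this

/-- Separation of a point from an open convex cone in a product. -/
theorem exists_separating_pair {V W : Type*} [NormedAddCommGroup V] [NormedSpace ℝ V]
    [NormedAddCommGroup W] [NormedSpace ℝ W] {Γ : Set (V × W)} (hopen : IsOpen Γ)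
    (hadd : ∀ p ∈ Γ, ∀ q ∈ Γ, p + q ∈ Γ) (hsmul : ∀ p ∈ Γ, ∀ c : ℝ, 0 < c → c • p ∈ Γ)
    (hne : Γ.Nonempty) {v₀ : V} {w₀ : W} (h₀ : (v₀, w₀) ∉ Γ) :
    ∃ (F : StrongDual ℝ V) (Λ : StrongDual ℝ W), (∀ v w, (v, w) ∈ Γ → F v ≤ Λ w) ∧
      Λ w₀ ≤ F v₀ ∧ ∀ w, (v₀, w) ∈ Γ → Λ w₀ < Λ w := by
  have hconv : Convex ℝ Γ := convex_iff_forall_pos.mpr fun p hp q hq a b ha hb _ =>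
    hadd _ (hsmul p hp a ha) _ (hsmul q hq b hb)
  obtain ⟨ℓ, hℓ⟩ := geometric_hahn_banach_open_point hconv hopen h₀
  set F : StrongDual ℝ V := ℓ.comp (ContinuousLinearMap.inl ℝ V W) with hF
  set Λ : StrongDual ℝ W := -ℓ.comp (ContinuousLinearMap.inr ℝ V W) with hΛ
  have hsplit : ∀ v w, ℓ (v, w) = F v - Λ w := by
    intro v w
    have : ((v, w) : V × W) = (v, 0) + (0, w) := by simp
    rw [this, map_add]
    simp [hF, hΛ]
  refine ⟨F, Λ, fun v w h => ?_, ?_, fun w h => ?_⟩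
  -- A point of the cone with positive ℓ could be scaled until it exceeds the separating value.
  · by_contra! hlt
    have hd : 0 < ℓ (v, w) := by rw [hsplit]; linarith
    have h1 := hℓ _ (hsmul _ h ((|ℓ (v₀, w₀)| + 1) / ℓ (v, w)) (by positivity))
    rw [map_smul, smul_eq_mul, div_mul_cancel₀ _ hd.ne'] at h1
    linarith [le_abs_self (ℓ (v₀, w₀))]
  -- Scaling a point of the cone towards 0 shows that the separating value is not negative.
  · suffices 0 ≤ ℓ (v₀, w₀) by rw [hsplit] at this; linarith
    by_contra! hneg
    obtain ⟨p, hp⟩ := hne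
    have hA0 : 0 < |ℓ p| + 1 := by positivity
    have h1 := hℓ _ (hsmul p hp (-ℓ (v₀, w₀) / (|ℓ p| + 1)) (div_pos (by linarith) hA0))
    rw [map_smul, smul_eq_mul] at h1
    have h3 : -1 ≤ ℓ p / (|ℓ p| + 1) := by
      rw [le_div_iff₀ hA0]
      linarith [neg_abs_le (ℓ p)]
    have h4 : -ℓ (v₀, w₀) / (|ℓ p| + 1) * ℓ p = -ℓ (v₀, w₀) * (ℓ p / (|ℓ p| + 1)) := by ring
    rw [h4] at h1
    nlinarith
  · have := hℓ _ h
    rw [hsplit, hsplit] at this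
    linarith

variable [FiniteDimensional 𝕜 X]

theorem exists_measure_of_positive (Λ : C(DualBall 𝕜 X, ℝ) →ₗ[ℝ] ℝ)
    (hpos : ∀ f : C(DualBall 𝕜 X, ℝ), (∀ η, 0 < f η) → 0 ≤ Λ f)
    (hone : Λ (ContinuousMap.const _ 1) = 1) :
    ∃ μ : Measure (DualBall 𝕜 X), IsProbabilityMeasure μ ∧ ∀ f, ∫ η, f η ∂μ = Λ f := by
  have hnn : ∀ f : C(DualBall 𝕜 X, ℝ), 0 ≤ f → 0 ≤ Λ f := by
    intro f hf
    refine le_of_forall_pos_le_add fun ε hε => ?_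
    have h1 := hpos (f + ε • ContinuousMap.const _ 1) fun η => by
      have : 0 ≤ f η := hf η
      simp
      linarith
    rw [map_add, map_smul, hone] at h1
    simpa using h1
  let J : CompactlySupportedContinuousMap (DualBall 𝕜 X) ℝ →ₗ[ℝ] C(DualBall 𝕜 X, ℝ) :=
    { toFun := fun f => f.toContinuousMap
      map_add' := fun _ _ => rfl
      map_smul' := fun _ _ => rfl }
  let Λ' := PositiveLinearMap.mk₀ (Λ.comp J) (fun f hf => hnn _ hf)
  have key : ∀ f : C(DualBall 𝕜 X, ℝ), ∫ η, f η ∂(RealRMK.rieszMeasure Λ') = Λ f := by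
    intro f
    exact RealRMK.integral_rieszMeasure Λ' (CompactlySupportedContinuousMap.continuousMapEquiv f)
  refine ⟨RealRMK.rieszMeasure Λ', ⟨?_⟩, key⟩
  have h1 := key (ContinuousMap.const _ 1)
  rw [hone] at h1
  simp only [ContinuousMap.const_apply, integral_const, smul_eq_mul, mul_one] at h1
  rw [measureReal_def] at h1
  exact (ENNReal.toReal_eq_one_iff _).mp h1

/-- The separating real functional is normalised by Λ(1), represented by a measure on the function
side, and extended to a 𝕜-linear functional with the same real part on the operator side. Domination
results from testing on single rank-one operators. -/
theorem exists_functional_of_notMem_factorCone_of_isScalarTower [NormedSpace ℝ (X →L[𝕜] X)]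
    [IsScalarTower ℝ 𝕜 (X →L[𝕜] X)] {M : ℝ}
    (hM : (ContinuousLinearMap.id 𝕜 X, ContinuousMap.const _ M) ∉ factorCone 𝕜 X) :
    ∃ (F : StrongDual 𝕜 (X →L[𝕜] X)) (μ : Measure (DualBall 𝕜 X)), IsProbabilityMeasure μ ∧
      M ≤ RCLike.re (F (ContinuousLinearMap.id 𝕜 X)) ∧
      ∀ (s : DualBall 𝕜 X) (b : X), RCLike.re (F ((s : StrongDual 𝕜 X).smulRight b)) ≤
        ∫ η : DualBall 𝕜 X, ‖(η : StrongDual 𝕜 X) b‖ ∂μ := by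
  obtain ⟨K, hK, hKm⟩ := exists_forall_mem_factorCone (𝕜 := 𝕜) (X := X)
  have hbig := hKm (ContinuousLinearMap.id 𝕜 X)
    (ContinuousMap.const _ (K * ‖ContinuousLinearMap.id 𝕜 X‖ + 1)) (fun η => by simp)
  have hsmul : ∀ p ∈ factorCone 𝕜 X, ∀ c : ℝ, 0 < c → c • p ∈ factorCone 𝕜 X := by
    rintro ⟨v, f⟩ hp c hc
    have h1 : c • (v, f) = ((c : 𝕜) • v, c • f) :=
      Prod.ext (RCLike.real_smul_eq_coe_smul c v) rfl
    rw [h1]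
    exact factorCone_smul hp hc
  obtain ⟨F₀, Λ₀, hcone, hc0, hstrict⟩ :=
    exists_separating_pair (V := X →L[𝕜] X) (W := C(DualBall 𝕜 X, ℝ))
      (isOpen_factorCone (𝕜 := 𝕜) (X := X)) (fun p hp q hq => factorCone_add hp hq) hsmul
      ⟨_, hbig⟩ hM
  have hconst : ∀ r : ℝ, Λ₀ (ContinuousMap.const _ r) = r * Λ₀ (ContinuousMap.const _ 1) := by
    intro r
    rw [← smul_eq_mul, ← map_smul]
    congr 1
    ext
    simp
  have hpos : ∀ f : C(DualBall 𝕜 X, ℝ), (∀ η, 0 < f η) → 0 ≤ Λ₀ f := by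
    intro f hf
    have := hcone 0 f (mem_factorCone_of_pos hf)
    rwa [map_zero] at this
  -- If Λ(1) were 0, then Λ would vanish on all constants, against the strict separation of (id, M)
  -- from (id, a large constant).
  have hΛ1 : 0 < Λ₀ (ContinuousMap.const _ 1) := by
    refine (hpos _ fun η => by simp).lt_of_ne fun h0 => ?_
    have h1 := hstrict _ hbig
    rw [hconst, hconst (_ + 1), ← h0, mul_zero, mul_zero] at h1
    exact lt_irrefl _ h1
  set a := (Λ₀ (ContinuousMap.const _ 1))⁻¹ with ha
  have ha0 : 0 < a := inv_pos.mpr hΛ1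
  obtain ⟨μ, hμ, hint⟩ := exists_measure_of_positive (𝕜 := 𝕜) (X := X) (a • Λ₀.toLinearMap)
    (fun f hf => mul_nonneg ha0.le (hpos f hf)) (inv_mul_cancel₀ hΛ1.ne')
  refine ⟨StrongDual.extendRCLike (a • F₀), μ, hμ, ?_, fun s b => ?_⟩
  · rw [StrongDual.re_extendRCLike_apply]
    have h2 := hc0
    rw [hconst] at h2
    have h3 := mul_le_mul_of_nonneg_left h2 ha0.le
    calc M = a * (M * Λ₀ (ContinuousMap.const _ 1)) := by rw [ha]; field_simp
      _ ≤ _ := h3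
  · rw [StrongDual.re_extendRCLike_apply]
    set N : C(DualBall 𝕜 X, ℝ) := ⟨_, (DualBall.continuous_apply (𝕜 := 𝕜) b).norm⟩ with hN
    have h1 : ∫ η : DualBall 𝕜 X, ‖(η : StrongDual 𝕜 X) b‖ ∂μ = a * Λ₀ N := hint N
    rw [h1]
    refine mul_le_mul_of_nonneg_left ?_ ha0.le
    refine le_of_forall_pos_le_add fun ε hε => ?_
    have h2 := hcone _ _ (mem_factorCone_single s b
      (f := N + (ε * a) • ContinuousMap.const _ 1) (fun η => by
        simp [hN]; positivity))
    rw [map_add, map_smul, smul_eq_mul, mul_assoc, ha, inv_mul_cancel₀ hΛ1.ne', mul_one] at h2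
    exact h2

/-- If the identity does not factor through a finite-dimensional `ℓ∞` with constant less than `M`,
then there is a trace functional of size `M` that is dominated by a measure on the dual ball. -/
theorem exists_functional_of_notMem_factorCone {M : ℝ}
    (hM : (ContinuousLinearMap.id 𝕜 X, ContinuousMap.const _ M) ∉ factorCone 𝕜 X) :
    ∃ (F : StrongDual 𝕜 (X →L[𝕜] X)) (μ : Measure (DualBall 𝕜 X)), IsProbabilityMeasure μ ∧
      M ≤ RCLike.re (F (ContinuousLinearMap.id 𝕜 X)) ∧
      ∀ (s : DualBall 𝕜 X) (b : X), RCLike.re (F ((s : StrongDual 𝕜 X).smulRight b)) ≤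
        ∫ η : DualBall 𝕜 X, ‖(η : StrongDual 𝕜 X) b‖ ∂μ := by
  let i : NormedSpace ℝ (X →L[𝕜] X) := NormedSpace.restrictScalars ℝ 𝕜 _
  have h : IsScalarTower ℝ 𝕜 (X →L[𝕜] X) :=
    ⟨fun r z v => by rw [RCLike.real_smul_eq_coe_mul, mul_smul]; rfl⟩
  exact exists_functional_of_notMem_factorCone_of_isScalarTower hM

end Separation

/-! ### Projections from factorizations, and lower bounds by traces -/

section Factorization

variable {𝕜 : Type} [RCLike 𝕜] {X : Type u} [NormedAddCommGroup X] [NormedSpace 𝕜 X]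

/-- A factorization of the identity through `ℓ∞` yields projections onto every copy of `X`. -/
theorem absProjConst_lt_of_mem_factorCone [FiniteDimensional 𝕜 X] {M : ℝ}
    (hM : (ContinuousLinearMap.id 𝕜 X, ContinuousMap.const _ M) ∈ factorCone 𝕜 X) :
    ∃ M' : ℝ, 0 ≤ M' ∧ M' < M ∧ absProjConst 𝕜 X ≤ ENNReal.ofReal M' := by
  obtain ⟨ι, _, s, b, h1, h2⟩ := hM
  obtain ⟨ε, hε, hle⟩ := exists_pos_le_of_pos (𝕜 := 𝕜) (X := X)
    (h := fun η => M - ∑ k, ‖(η : StrongDual 𝕜 X) (b k)‖)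
    (continuous_const.sub
      (continuous_finsetSum _ fun k _ => (DualBall.continuous_apply (b k)).norm))
    (fun η => sub_pos.mpr (h2 η))
  have hsum : ∀ η : DualBall 𝕜 X, ∑ k, ‖(η : StrongDual 𝕜 X) (b k)‖ ≤ M - ε := fun η => by
    linarith [hle η]
  have hM0 : 0 ≤ M - ε :=
    (Finset.sum_nonneg fun k _ => norm_nonneg _).trans (hsum (Classical.arbitrary _))
  refine ⟨M - ε, hM0, by linarith, ?_⟩
  unfold absProjConst
  refine iSup_le fun Z => iSup_le fun _ => iSup_le fun _ => iSup_le fun T => ?_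
  let e : X ≃ₗᵢ[𝕜] LinearMap.range T.toLinearMap := T.equivRange
  have he : ∀ y, ((e y : LinearMap.range T.toLinearMap) : Z) = T y := fun y => rfl
  -- Hahn–Banach extends the s k to the ambient space without increasing their norm; the resulting ∑
  -- G k ⊗ b k is the projection, up to the isometry.
  have hext : ∀ k, ∃ G : StrongDual 𝕜 Z, ‖G‖ ≤ 1 ∧ ∀ y, G (T y) = (s k : StrongDual 𝕜 X) y := by
    intro k
    obtain ⟨G, hG, hGn⟩ := exists_extension_norm_eq (LinearMap.range T.toLinearMap)
      ((s k : StrongDual 𝕜 X).comp (e.symm.toContinuousLinearEquiv : _ →L[𝕜] X))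
    refine ⟨G, ?_, fun y => ?_⟩
    · rw [hGn]
      refine ContinuousLinearMap.opNorm_le_bound _ zero_le_one fun z => ?_
      calc _ ≤ 1 * ‖e.symm z‖ := (s k : StrongDual 𝕜 X).le_of_opNorm_le (s k).norm_le _
        _ = 1 * ‖z‖ := by rw [e.symm.norm_map]
    · have := hG (e y)
      rw [he] at this
      rw [this]
      simp
  choose G hG1 hG2 using hext
  let Q : Z →L[𝕜] X := ∑ k, (G k).smulRight (b k)
  have hQ : ∀ z, Q z = ∑ k, G k z • b k := fun z => by simp [Q]
  have hQn : ∀ z, ‖Q z‖ ≤ (M - ε) * ‖z‖ := by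
    intro z
    obtain ⟨g, hg1, hg2⟩ := exists_dual_vector'' 𝕜 (Q z)
    have h3 : ‖Q z‖ = ‖g (Q z)‖ := by simp [hg2]
    rw [h3, hQ, map_sum]
    calc ‖∑ k, g (G k z • b k)‖ ≤ ∑ k, ‖g (G k z • b k)‖ := norm_sum_le _ _
      _ ≤ ∑ k, ‖z‖ * ‖g (b k)‖ := by
        refine Finset.sum_le_sum fun k _ => ?_
        rw [map_smul, norm_smul]
        refine mul_le_mul_of_nonneg_right ?_ (norm_nonneg _)
        simpa using (G k).le_of_opNorm_le (hG1 k) z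
      _ = (∑ k, ‖g (b k)‖) * ‖z‖ := by rw [← Finset.mul_sum, mul_comm]
      _ ≤ _ := by
        gcongr
        exact hsum ⟨g, mem_closedBall_zero_iff.mpr hg1⟩
  let P : Z →L[𝕜] LinearMap.range T.toLinearMap :=
    (e.toContinuousLinearEquiv : X →L[𝕜] _).comp Q
  have hP : ∀ y : LinearMap.range T.toLinearMap, P (y : Z) = y := by
    intro y
    obtain ⟨x, rfl⟩ := e.surjective y
    have : Q (T x) = x := by
      rw [hQ]
      simp only [hG2]
      have := congrArg (fun v : X →L[𝕜] X => v x) h1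
      simpa using this.symm
    rw [he]
    change e (Q (T x)) = e x
    rw [this]
  unfold relProjConst
  refine (iInf₂_le P hP).trans (ENNReal.ofReal_le_ofReal ?_)
  refine ContinuousLinearMap.opNorm_le_bound _ hM0 fun z => ?_
  calc ‖e (Q z)‖ = ‖Q z‖ := e.norm_map _
    _ ≤ _ := hQn z

/-- Take traces: the identity has trace n, and a rank-one operator ξ ⊗ q has trace ξ(q). -/
lemma trace_id_le_of_eq_sum [FiniteDimensional 𝕜 X] {d : ℕ} {ξ : Fin d → StrongDual 𝕜 X}
    (hξ : ∀ i, ‖ξ i‖ ≤ 1) {c p : ℝ} (hc : 0 ≤ c) {q : Fin d → X} (hq : ∀ i, ‖q i‖ ≤ p)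
    (h : ∀ y, y = (c : 𝕜) • ∑ i, ξ i y • q i) : (Module.finrank 𝕜 X : ℝ) ≤ c * d * p := by
  have h1 : (LinearMap.id : X →ₗ[𝕜] X) =
      (c : 𝕜) • ∑ i, (ξ i : X →ₗ[𝕜] 𝕜).smulRight (q i) := by
    ext y
    simpa using h y
  have h2 := congrArg (LinearMap.trace 𝕜 X) h1
  rw [LinearMap.trace_id, map_smul, map_sum] at h2
  simp only [LinearMap.trace_smulRight] at h2
  have h3 : (Module.finrank 𝕜 X : ℝ) = ‖(c : 𝕜) • ∑ i, (ξ i : X →ₗ[𝕜] 𝕜) (q i)‖ := by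
    rw [← h2]; simp
  rw [h3, norm_smul, RCLike.norm_ofReal, abs_of_nonneg hc, mul_assoc]
  refine mul_le_mul_of_nonneg_left ?_ hc
  calc _ ≤ ∑ i, ‖ξ i (q i)‖ := norm_sum_le _ _
    _ ≤ ∑ _i : Fin d, p := Finset.sum_le_sum fun i _ => by
      calc ‖ξ i (q i)‖ ≤ 1 * ‖q i‖ := (ξ i).le_of_opNorm_le (hξ i) _
        _ ≤ p := by rw [one_mul]; exact hq i
    _ = d * p := by simp

/-- Applying a projection P to the expansion of J y writes the identity of X as c ∑ ξ i ⊗ q i with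
‖q i‖ ≤ ‖P‖, so the trace bounds ‖P‖ from below. -/
lemma le_relProjConst [FiniteDimensional 𝕜 X] {d : ℕ} {ξ : Fin d → StrongDual 𝕜 X}
    (hξ : ∀ i, ‖ξ i‖ ≤ 1) {c δ : ℝ} (hc : 0 ≤ c) (hδ : ∀ p, Module.finrank 𝕜 X ≤ c * d * p → δ ≤ p)
    {Z : Type u} [NormedAddCommGroup Z] [NormedSpace 𝕜 Z] (J : X →ₗᵢ[𝕜] Z) {z : Fin d → Z}
    (hz : ∀ i, ‖z i‖ ≤ 1) (hJ : ∀ y, J y = (c : 𝕜) • ∑ i, ξ i y • z i) :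
    ENNReal.ofReal δ ≤ relProjConst (LinearMap.range J.toLinearMap) := by
  refine le_iInf₂ fun P hP => ENNReal.ofReal_le_ofReal (hδ _ ?_)
  let e : X ≃ₗᵢ[𝕜] LinearMap.range J.toLinearMap := J.equivRange
  refine trace_id_le_of_eq_sum hξ hc (q := fun i => e.symm (P (z i))) (fun i => ?_) fun y => ?_
  · rw [e.symm.norm_map]
    exact (P.le_opNorm _).trans (mul_le_of_le_one_right (norm_nonneg _) (hz i))
  · have h1 : P (J y) = e y := hP (e y)
    rw [hJ] at h1
    simpa using (congrArg e.symm h1).symm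

/-- If the dual ball lies in a multiple of the zonotope of few of its points, then the projection
constant is large. -/
theorem le_absProjConst [FiniteDimensional 𝕜 X] {d : ℕ} {ξ : Fin d → StrongDual 𝕜 X}
    (hξ : ∀ i, ‖ξ i‖ ≤ 1) {c δ : ℝ} (hc : 0 ≤ c) (hδ : ∀ p, Module.finrank 𝕜 X ≤ c * d * p → δ ≤ p)
    (h : ∀ s : StrongDual 𝕜 X, ‖s‖ ≤ 1 → ∃ a : Fin d → 𝕜, (∀ i, ‖a i‖ ≤ 1) ∧
      s = (c : 𝕜) • ∑ i, a i • ξ i) :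
    ENNReal.ofReal δ ≤ absProjConst 𝕜 X := by
  choose! a ha1 ha2 using h
  let Z := lp (fun _ : DualBall 𝕜 X => 𝕜) ∞
  have hmem : ∀ (f : DualBall 𝕜 X → 𝕜) (C : ℝ), (∀ s, ‖f s‖ ≤ C) → Memℓp f ∞ := fun f C hf =>
    memℓp_infty ⟨C, by rintro _ ⟨s, rfl⟩; exact hf s⟩
  have hbd : ∀ (y : X) (s : DualBall 𝕜 X), ‖(s : StrongDual 𝕜 X) y‖ ≤ ‖y‖ := fun y s => by
    simpa using (s : StrongDual 𝕜 X).le_of_opNorm_le s.norm_le y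
  let J : X →ₗᵢ[𝕜] Z :=
    { toFun := fun y => ⟨fun s => (s : StrongDual 𝕜 X) y, hmem _ _ (hbd y)⟩
      map_add' := fun y y' => by ext s; exact map_add (s : StrongDual 𝕜 X) y y'
      map_smul' := fun k y => by ext s; exact map_smul (s : StrongDual 𝕜 X) k y
      norm_map' := fun y => by
        refine le_antisymm (lp.norm_le_of_forall_le (norm_nonneg _) (hbd y)) ?_
        obtain ⟨g, hg1, hg2⟩ := exists_dual_vector'' 𝕜 y
        have := lp.norm_apply_le_norm ENNReal.top_ne_zero
          (⟨fun s => (s : StrongDual 𝕜 X) y, hmem _ _ (hbd y)⟩ : Z)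
          ⟨g, mem_closedBall_zero_iff.mpr hg1⟩
        simpa [hg2] using this }
  -- The zonotope coefficients of s, read as a function of s, are elements of the unit ball of ℓ∞;
  -- they expand the canonical embedding.
  let z : Fin d → Z := fun i =>
    ⟨fun s => a s i, hmem _ 1 fun s => ha1 _ s.norm_le i⟩
  have hz : ∀ i, ‖z i‖ ≤ 1 := fun i =>
    lp.norm_le_of_forall_le zero_le_one fun s => ha1 _ s.norm_le i
  have hJ : ∀ y, J y = (c : 𝕜) • ∑ i, ξ i y • z i := by
    intro y
    ext s
    have h1 := congrArg (fun v : StrongDual 𝕜 X => v y) (ha2 s s.norm_le)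
    simp only [smul_apply, sum_apply] at h1
    change (s : StrongDual 𝕜 X) y = _
    rw [h1]
    rw [lp.coeFn_smul, Pi.smul_apply, lp.coeFn_sum, Finset.sum_apply]
    exact congrArg _ (Finset.sum_congr rfl fun i _ => mul_comm _ _)
  refine le_trans ?_ (le_iSup_of_le Z (le_iSup_of_le inferInstance
    (le_iSup_of_le inferInstance (le_iSup_of_le J le_rfl))))
  exact le_relProjConst hξ hc hδ J hz hJ

/-- A functional dominated by `∑ |r j|` is a combination of the `r j` with bounded coefficients. -/
theorem exists_eq_sum_of_norm_le {V : Type*} [AddCommGroup V] [Module 𝕜 V] {ι : Type*} [Fintype ι]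
    (r : ι → V →ₗ[𝕜] 𝕜) (f : V →ₗ[𝕜] 𝕜) {M : ℝ} (hM : 0 ≤ M)
    (h : ∀ y, ‖f y‖ ≤ M * ∑ j, ‖r j y‖) :
    ∃ a : ι → 𝕜, (∀ j, ‖a j‖ ≤ M) ∧ ∀ y, f y = ∑ j, a j * r j y := by
  classical
  -- The functional f factors through the range of y ↦ (r j y) in ℓ¹ with norm at most M. A
  -- Hahn–Banach extension evaluated at the unit vectors gives the coefficients.
  let L : V →ₗ[𝕜] PiLp 1 (fun _ : ι => 𝕜) :=
    (WithLp.linearEquiv 1 𝕜 (ι → 𝕜)).symm.toLinearMap ∘ₗ LinearMap.pi r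
  have hL : ∀ y j, L y j = r j y := fun y j => rfl
  obtain ⟨g, hg⟩ := L.rangeRestrict.exists_rightInverse_of_surjective L.range_rangeRestrict
  have hg' : ∀ v : LinearMap.range L, L (g v) = v := fun v =>
    congrArg Subtype.val (LinearMap.congr_fun hg v)
  have hbd : ∀ v : LinearMap.range L, ‖(f ∘ₗ g) v‖ ≤ M * ‖v‖ := by
    intro v
    have h1 : ‖v‖ = ∑ j, ‖r j (g v)‖ := by
      rw [show ‖v‖ = ‖(v : PiLp 1 fun _ : ι => 𝕜)‖ from rfl, ← hg' v, PiLp.norm_eq_of_L1]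
      simp only [hL]
    rw [h1]
    exact h _
  obtain ⟨G, hG, hGn⟩ := exists_extension_norm_eq _ ((f ∘ₗ g).mkContinuous M hbd)
  have hGM : ‖G‖ ≤ M := hGn.trans_le (LinearMap.mkContinuous_norm_le _ hM _)
  refine ⟨fun j => G (PiLp.single 1 j 1), fun j => ?_, fun y => ?_⟩
  · simpa [PiLp.norm_single] using G.le_of_opNorm_le hGM (PiLp.single 1 j (1 : 𝕜))
  · have h1 : f y = G (L y) := by
      have h2 := hG (L.rangeRestrict y)
      have h3 : L (g (L.rangeRestrict y)) = L y := hg' _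
      have h4 : ‖f (y - g (L.rangeRestrict y))‖ ≤ 0 := by
        refine (h _).trans (le_of_eq ?_)
        simp only [← hL, map_sub, h3]
        simp
      have h5 := norm_le_zero_iff.mp h4
      rw [map_sub, sub_eq_zero] at h5
      rw [h5]
      exact h2.symm
    have h6 : L y = ∑ j, r j y • PiLp.single 1 j (1 : 𝕜) := by
      ext j
      simp [hL, Finset.sum_apply, Pi.single_apply]
    rw [h1, h6, map_sum]
    simp [mul_comm]

end Factorization

/-! ### Isotropic coordinates and the bound for the trace functional -/

section IsotropicBasis

variable {𝕜 : Type} [RCLike 𝕜] {X : Type u} [NormedAddCommGroup X] [NormedSpace 𝕜 X]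
  {n : ℕ}

/-- A positive semidefinite sesquilinear form has an orthogonal basis of vectors of length `0` or
`1`. -/
theorem exists_basis_of_form [FiniteDimensional 𝕜 X] (hn : Module.finrank 𝕜 X = n) (h : X →ₗ⋆[𝕜] X →ₗ[𝕜] 𝕜)
    (hsymm : ∀ x y, starRingEnd 𝕜 (h x y) = h y x) (hnn : ∀ x, 0 ≤ RCLike.re (h x x)) :
    ∃ (e : Module.Basis (Fin n) 𝕜 X) (ε : Fin n → ℝ), (∀ i, ε i = 0 ∨ ε i = 1) ∧
      ∀ i j, h (e i) (e j) = if i = j then (ε i : 𝕜) else 0 := by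
  let b := Module.finBasisOfFinrankEq 𝕜 X hn
  let f : EuclideanSpace 𝕜 (Fin n) ≃ₗ[𝕜] X :=
    (WithLp.linearEquiv 2 𝕜 (Fin n → 𝕜)).trans b.equivFun.symm
  have hf : ∀ x, f x = ∑ i, x i • b i := fun x => by simp [f, Module.Basis.equivFun_symm_apply]
  let R : EuclideanSpace 𝕜 (Fin n) →ₗ[𝕜] EuclideanSpace 𝕜 (Fin n) :=
    (WithLp.linearEquiv 2 𝕜 (Fin n → 𝕜)).symm.toLinearMap ∘ₗ
      LinearMap.pi fun i => (h (b i)) ∘ₗ f.toLinearMap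
  have hR : ∀ x y, inner 𝕜 x (R y) = h (f x) (f y) := by
    intro x y
    rw [hf x, PiLp.inner_apply]
    simp [R, mul_comm]
  have hRs : R.IsSymmetric := by
    intro x y
    rw [← inner_conj_symm, hR, hR, hsymm]
  have hfin : Module.finrank 𝕜 (EuclideanSpace 𝕜 (Fin n)) = n := by simp
  let v := hRs.eigenvectorBasis hfin
  let l := hRs.eigenvalues hfin
  have hv : ∀ i j, h (f (v i)) (f (v j)) = if i = j then (l i : 𝕜) else 0 := by
    intro i j
    rw [← hR, hRs.apply_eigenvectorBasis, inner_smul_right]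
    rw [orthonormal_iff_ite.mp v.orthonormal i j]
    split_ifs with hij
    · rw [hij, mul_one]
    · rw [mul_zero]
  have hl : ∀ i, 0 ≤ l i := by
    intro i
    have := hnn (f (v i))
    rw [hv] at this
    simpa using this
  -- Eigenvectors in the kernel are left unscaled; they become the directions with ε i = 0.
  let c : Fin n → ℝ := fun i => if l i = 0 then 1 else (Real.sqrt (l i))⁻¹
  have hc : ∀ i, c i ≠ 0 := by
    intro i
    simp only [c]
    split_ifs with h0
    · exact one_ne_zero
    · exact inv_ne_zero (Real.sqrt_ne_zero'.mpr ((hl i).lt_of_ne' h0))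
  let e : Module.Basis (Fin n) 𝕜 X := (v.toBasis.map f).isUnitSMul (w := fun i => (c i : 𝕜))
    (fun i => (RCLike.ofReal_ne_zero.mpr (hc i)).isUnit)
  have he : ∀ i, e i = (c i : 𝕜) • f (v i) := fun i => by
    simp [e, Module.Basis.isUnitSMul_apply]
  refine ⟨e, fun i => c i ^ 2 * l i, fun i => ?_, fun i j => ?_⟩
  · simp only [c]
    split_ifs with h0
    · left; simp [h0]
    · right
      rw [inv_pow, Real.sq_sqrt (hl i), inv_mul_cancel₀ h0]
  · rw [he, he, h.map_smulₛₗ, LinearMap.smul_apply, map_smul, hv, RCLike.conj_ofReal]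
    split_ifs with hij
    · subst hij
      simp only [smul_eq_mul]
      push_cast
      ring
    · simp

/-- The coordinates of a functional with respect to a basis. -/
def dualCoords (e : Module.Basis (Fin n) 𝕜 X) : StrongDual 𝕜 X →ₗ[𝕜] EuclideanSpace 𝕜 (Fin n) :=
  (WithLp.linearEquiv 2 𝕜 (Fin n → 𝕜)).symm.toLinearMap ∘ₗ
    LinearMap.pi fun i =>
      (ContinuousLinearMap.apply 𝕜 𝕜 (e i) : StrongDual 𝕜 X →L[𝕜] 𝕜).toLinearMap

lemma dualCoords_apply (e : Module.Basis (Fin n) 𝕜 X) (s : StrongDual 𝕜 X) (i : Fin n) :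
    dualCoords e s i = s (e i) := rfl

/-- The vector on which a functional acts by `η ↦ ⟨dualCoords e ξ, dualCoords e η⟩`. -/
def dualVec (e : Module.Basis (Fin n) 𝕜 X) (ξ : StrongDual 𝕜 X) : X :=
  ∑ i, starRingEnd 𝕜 (ξ (e i)) • e i

lemma apply_dualVec (e : Module.Basis (Fin n) 𝕜 X) (ξ η : StrongDual 𝕜 X) :
    η (dualVec e ξ) = inner 𝕜 (dualCoords e ξ) (dualCoords e η) := by
  simp [dualVec, dualCoords_apply, PiLp.inner_apply, mul_comm]

lemma continuous_dualCoords (e : Module.Basis (Fin n) 𝕜 X) :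
    Continuous fun η : DualBall 𝕜 X => dualCoords e (η : StrongDual 𝕜 X) :=
  (PiLp.continuous_toLp 2 _).comp (continuous_pi fun i => DualBall.continuous_apply (e i))

variable {F : StrongDual 𝕜 (X →L[𝕜] X)}

lemma re_apply_smulRight_le {μ : Measure (DualBall 𝕜 X)}
    (hF : ∀ (s : DualBall 𝕜 X) (b : X), RCLike.re (F ((s : StrongDual 𝕜 X).smulRight b)) ≤
      ∫ η : DualBall 𝕜 X, ‖(η : StrongDual 𝕜 X) b‖ ∂μ) (s : StrongDual 𝕜 X) (b : X) :
    RCLike.re (F (s.smulRight b)) ≤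
      ‖s‖ * ∫ η : DualBall 𝕜 X, ‖(η : StrongDual 𝕜 X) b‖ ∂μ := by
  rcases eq_or_ne s 0 with rfl | hs
  · have : (0 : StrongDual 𝕜 X).smulRight b = 0 := by ext; simp
    simp [this]
  · have hs' : 0 < ‖s‖ := norm_pos_iff.mpr hs
    have h1 := hF ⟨((‖s‖⁻¹ : ℝ) : 𝕜) • s, by
      rw [mem_closedBall_zero_iff, norm_smul, RCLike.norm_ofReal, abs_of_pos (inv_pos.mpr hs'),
        inv_mul_cancel₀ hs'.ne']⟩ b
    have h2 : (((‖s‖⁻¹ : ℝ) : 𝕜) • s).smulRight b = ((‖s‖⁻¹ : ℝ) : 𝕜) • s.smulRight b := by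
      ext y; simp [mul_smul]
    simp only [h2, map_smul, smul_eq_mul, RCLike.re_ofReal_mul] at h1
    rwa [inv_mul_le_iff₀ hs'] at h1

variable [FiniteDimensional 𝕜 X] (μ : Measure (DualBall 𝕜 X)) [IsProbabilityMeasure μ]

lemma DualBall.integrable_of_continuous {E : Type*} [NormedAddCommGroup E]
    {f : DualBall 𝕜 X → E} (hf : Continuous f) : Integrable f μ :=
  hf.integrable_of_hasCompactSupport (HasCompactSupport.of_compactSpace f)

/-- The form `(x, y) ↦ ∫ conj (η x) η y`. -/
def momentForm : X →ₗ⋆[𝕜] X →ₗ[𝕜] 𝕜 :=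
  LinearMap.mk₂'ₛₗ _ _ (fun x y => ∫ η : DualBall 𝕜 X,
      starRingEnd 𝕜 ((η : StrongDual 𝕜 X) x) * (η : StrongDual 𝕜 X) y ∂μ)
    (fun x x' y => by
      simp only [map_add, add_mul]
      exact integral_add (DualBall.integrable_of_continuous μ
        ((RCLike.continuous_conj.comp (DualBall.continuous_apply x)).mul
          (DualBall.continuous_apply y))) (DualBall.integrable_of_continuous μ
        ((RCLike.continuous_conj.comp (DualBall.continuous_apply x')).mul
          (DualBall.continuous_apply y))))
    (fun c x y => by
      simp only [map_smul, smul_eq_mul, map_mul, mul_assoc]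
      exact integral_const_mul _ _)
    (fun x y y' => by
      simp only [map_add, mul_add]
      exact integral_add (DualBall.integrable_of_continuous μ
        ((RCLike.continuous_conj.comp (DualBall.continuous_apply x)).mul
          (DualBall.continuous_apply y))) (DualBall.integrable_of_continuous μ
        ((RCLike.continuous_conj.comp (DualBall.continuous_apply x)).mul
          (DualBall.continuous_apply y'))))
    (fun c x y => by
      simp only [map_smul, smul_eq_mul, mul_left_comm _ c]
      exact integral_const_mul _ _)

lemma momentForm_apply (x y : X) : momentForm μ x y = ∫ η : DualBall 𝕜 X,
    starRingEnd 𝕜 ((η : StrongDual 𝕜 X) x) * (η : StrongDual 𝕜 X) y ∂μ := rfl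

lemma momentForm_self (x : X) : momentForm μ x x =
    ((∫ η : DualBall 𝕜 X, ‖(η : StrongDual 𝕜 X) x‖ ^ 2 ∂μ : ℝ) : 𝕜) := by
  rw [momentForm_apply, ← integral_ofReal]
  congr 1
  ext η
  rw [RCLike.conj_mul]
  push_cast
  rfl

theorem exists_isotropic_basis (hn : Module.finrank 𝕜 X = n) :
    ∃ (e : Module.Basis (Fin n) 𝕜 X) (ε : Fin n → ℝ), (∀ i, ε i = 0 ∨ ε i = 1) ∧
      ∀ i j, momentForm μ (e i) (e j) = if i = j then (ε i : 𝕜) else 0 := by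
  refine exists_basis_of_form hn _ (fun x y => ?_) fun x => ?_
  · rw [momentForm_apply, momentForm_apply, ← integral_conj]
    simp [mul_comm]
  · rw [momentForm_self, RCLike.ofReal_re]
    exact integral_nonneg fun η => by positivity

variable {μ} {e : Module.Basis (Fin n) 𝕜 X} {ε : Fin n → ℝ}

lemma integral_norm_inner_sq
    (he : ∀ i j, momentForm μ (e i) (e j) = if i = j then (ε i : 𝕜) else 0)
    (y : EuclideanSpace 𝕜 (Fin n)) :
    ∫ η : DualBall 𝕜 X, ‖inner 𝕜 (dualCoords e (η : StrongDual 𝕜 X)) y‖ ^ 2 ∂μ =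
      ∑ i, ε i * ‖y i‖ ^ 2 := by
  set Y : X := ∑ i, starRingEnd 𝕜 (y i) • e i with hY
  have h1 : ∀ η : DualBall 𝕜 X, ‖inner 𝕜 (dualCoords e (η : StrongDual 𝕜 X)) y‖ ^ 2 =
      ‖(η : StrongDual 𝕜 X) Y‖ ^ 2 := by
    intro η
    rw [norm_inner_symm, PiLp.inner_apply, hY]
    simp [dualCoords_apply, mul_comm]
  simp_rw [h1]
  have h2 := momentForm_self μ Y
  apply RCLike.ofReal_injective (K := 𝕜)
  rw [← h2, hY]
  simp only [map_sum, map_smulₛₗ, LinearMap.sum_apply, LinearMap.smul_apply, he, smul_eq_mul,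
    RCLike.conj_conj, mul_ite, mul_zero, RingHom.id_apply]
  push_cast
  refine Finset.sum_congr rfl fun i _ => ?_
  simp
  rw [← RCLike.conj_mul]
  ring

/-- Expanding ξ ⊗ `dualVec` ξ in the basis and integrating leaves ∑ εᵢ F(cᵢ ⊗ eᵢ), while the
identity is ∑ cᵢ ⊗ eᵢ. The two agree in real part because degenerate directions contribute nothing.
-/
lemma re_apply_id_eq_integral
    (he : ∀ i j, momentForm μ (e i) (e j) = if i = j then (ε i : 𝕜) else 0)
    (hε : ∀ i, ε i = 0 ∨ ε i = 1)
    (hF : ∀ (s : DualBall 𝕜 X) (b : X), RCLike.re (F ((s : StrongDual 𝕜 X).smulRight b)) ≤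
      ∫ η : DualBall 𝕜 X, ‖(η : StrongDual 𝕜 X) b‖ ∂μ) :
    RCLike.re (F (ContinuousLinearMap.id 𝕜 X)) = ∫ ξ : DualBall 𝕜 X,
      RCLike.re (F ((ξ : StrongDual 𝕜 X).smulRight (dualVec e ξ))) ∂μ := by
  let c : Fin n → StrongDual 𝕜 X := fun j => (e.coord j).toContinuousLinearMap
  have hc : ∀ j y, c j y = e.repr y j := fun j y => rfl
  have hid : ContinuousLinearMap.id 𝕜 X = ∑ i, (c i).smulRight (e i) := by
    ext y
    simp only [sum_apply, ContinuousLinearMap.smulRight_apply, hc]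
    exact (e.sum_repr y).symm
  have hexp : ∀ ξ : StrongDual 𝕜 X, F (ξ.smulRight (dualVec e ξ)) =
      ∑ i, ∑ j, (starRingEnd 𝕜 (ξ (e i)) * ξ (e j)) * F ((c j).smulRight (e i)) := by
    intro ξ
    have h1 : ξ.smulRight (dualVec e ξ) =
        ∑ i, ∑ j, (starRingEnd 𝕜 (ξ (e i)) * ξ (e j)) • (c j).smulRight (e i) := by
      ext y
      simp only [dualVec, sum_apply, smul_apply, ContinuousLinearMap.smulRight_apply, hc,
        Finset.smul_sum, smul_smul]
      refine Finset.sum_congr rfl fun i _ => ?_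
      rw [← Finset.sum_smul]
      congr 1
      conv_lhs => rw [← e.sum_repr y]
      simp only [map_sum, map_smul, smul_eq_mul, Finset.sum_mul]
      exact Finset.sum_congr rfl fun j _ => by ring
    rw [h1]
    simp only [map_sum, map_smul, smul_eq_mul]
  have hcont : ∀ i j, Continuous fun ξ : DualBall 𝕜 X =>
      starRingEnd 𝕜 ((ξ : StrongDual 𝕜 X) (e i)) * (ξ : StrongDual 𝕜 X) (e j) := fun i j =>
    (RCLike.continuous_conj.comp (DualBall.continuous_apply _)).mul (DualBall.continuous_apply _)
  have hint : ∀ i j, Integrable (fun ξ : DualBall 𝕜 X =>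
      starRingEnd 𝕜 ((ξ : StrongDual 𝕜 X) (e i)) * (ξ : StrongDual 𝕜 X) (e j)
        * F ((c j).smulRight (e i))) μ := fun i j =>
    (DualBall.integrable_of_continuous μ (hcont i j)).mul_const _
  have hval : ∫ ξ : DualBall 𝕜 X, F ((ξ : StrongDual 𝕜 X).smulRight (dualVec e ξ)) ∂μ =
      ∑ i, (ε i : 𝕜) * F ((c i).smulRight (e i)) := by
    simp_rw [hexp]
    rw [integral_finsetSum _ fun i _ => integrable_finsetSum _ fun j _ => hint i j]
    refine Finset.sum_congr rfl fun i _ => ?_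
    rw [integral_finsetSum _ fun j _ => hint i j]
    simp_rw [integral_mul_const]
    simp only [← momentForm_apply, he]
    simp
  rw [integral_re (by
    simp_rw [hexp]
    exact integrable_finsetSum _ fun i _ => integrable_finsetSum _ fun j _ => hint i j), hval,
    hid, map_sum, map_sum, map_sum]
  refine Finset.sum_congr rfl fun i _ => ?_
  rw [RCLike.re_ofReal_mul]
  rcases hε i with h0 | h0
  · rw [h0, zero_mul]
    -- Almost every η annihilates a degenerate eᵢ, so the domination applied to both cᵢ and -cᵢ
    -- forces Re F(cᵢ ⊗ eᵢ) = 0.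
    have hz : ∫ η : DualBall 𝕜 X, ‖(η : StrongDual 𝕜 X) (e i)‖ ∂μ = 0 := by
      have h1 := momentForm_self μ (e i)
      rw [he, if_pos rfl, h0] at h1
      have h2 := (RCLike.ofReal_injective h1).symm
      have h3 : Integrable (fun η : DualBall 𝕜 X => ‖(η : StrongDual 𝕜 X) (e i)‖ ^ 2) μ :=
        DualBall.integrable_of_continuous μ ((DualBall.continuous_apply _).norm.pow 2)
      rw [integral_eq_zero_iff_of_nonneg (fun η => sq_nonneg _) h3] at h2
      refine integral_eq_zero_of_ae ?_
      filter_upwards [h2] with η hη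
      simpa using hη
    refine le_antisymm ?_ ?_
    · have := re_apply_smulRight_le hF (c i) (e i)
      rwa [hz, mul_zero] at this
    · have := re_apply_smulRight_le hF (-c i) (e i)
      have h3 : (-c i).smulRight (e i) = -(c i).smulRight (e i) := by ext; simp
      rw [hz, mul_zero, h3, map_neg, map_neg] at this
      linarith
  · rw [h0, one_mul]

/-- The trace of an operator dominated by a measure is at most `δ`; in the extremal case the measure
is isotropic and equiangular. -/
theorem re_apply_id_le (hn : 1 ≤ n) (hX : Module.finrank 𝕜 X = n)
    (hF : ∀ (s : DualBall 𝕜 X) (b : X), RCLike.re (F ((s : StrongDual 𝕜 X).smulRight b)) ≤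
      ∫ η : DualBall 𝕜 X, ‖(η : StrongDual 𝕜 X) b‖ ∂μ) :
    RCLike.re (F (ContinuousLinearMap.id 𝕜 X)) ≤ deltaConst 𝕜 n ∧
    (deltaConst 𝕜 n ≤ RCLike.re (F (ContinuousLinearMap.id 𝕜 X)) →
      ∃ e : Module.Basis (Fin n) 𝕜 X,
        (∀ i j, momentForm μ (e i) (e j) = if i = j then 1 else 0) ∧
        (∀ᵐ ξ : DualBall 𝕜 X ∂μ,
          RCLike.re (F ((ξ : StrongDual 𝕜 X).smulRight (dualVec e ξ))) =
            ∫ η : DualBall 𝕜 X, ‖(η : StrongDual 𝕜 X) (dualVec e ξ)‖ ∂μ) ∧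
        ∀ᵐ p : DualBall 𝕜 X × DualBall 𝕜 X ∂(μ.prod μ),
          ‖dualCoords e (p.1 : StrongDual 𝕜 X)‖ * ‖dualCoords e (p.2 : StrongDual 𝕜 X)‖ = n ∧
          (‖inner 𝕜 (dualCoords e (p.1 : StrongDual 𝕜 X))
              (dualCoords e (p.2 : StrongDual 𝕜 X))‖ = etfAngle 𝕜 n * n ∨
            ‖inner 𝕜 (dualCoords e (p.1 : StrongDual 𝕜 X))
              (dualCoords e (p.2 : StrongDual 𝕜 X))‖ = n)) := by
  obtain ⟨e, ε, hε, he⟩ := exists_isotropic_basis μ hX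
  have hcont := continuous_dualCoords e
  obtain ⟨R, hR⟩ : ∃ R, ∀ η : DualBall 𝕜 X, ‖dualCoords e (η : StrongDual 𝕜 X)‖ ≤ R := by
    obtain ⟨R, hR⟩ := (isCompact_range hcont).isBounded.exists_norm_le
    exact ⟨R, fun η => hR _ ⟨η, rfl⟩⟩
  obtain ⟨h1, h2⟩ := integral_norm_inner_le hn hcont.measurable hR hε (integral_norm_inner_sq he)
  have hid := re_apply_id_eq_integral he hε hF
  have hg : Integrable (fun p : DualBall 𝕜 X × DualBall 𝕜 X =>
      ‖inner 𝕜 (dualCoords e (p.1 : StrongDual 𝕜 X)) (dualCoords e (p.2 : StrongDual 𝕜 X))‖)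
      (μ.prod μ) := by
    refine Continuous.integrable_of_hasCompactSupport ?_ (HasCompactSupport.of_compactSpace _)
    exact ((hcont.comp continuous_fst).inner (hcont.comp continuous_snd)).norm
  have hi1 := hg.integral_prod_left
  have hle : ∀ ξ : DualBall 𝕜 X, RCLike.re (F ((ξ : StrongDual 𝕜 X).smulRight (dualVec e ξ))) ≤
      ∫ η : DualBall 𝕜 X, ‖inner 𝕜 (dualCoords e (ξ : StrongDual 𝕜 X))
        (dualCoords e (η : StrongDual 𝕜 X))‖ ∂μ := by
    intro ξ
    simp_rw [← apply_dualVec]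
    exact hF ξ _
  have hi2 : Integrable (fun ξ : DualBall 𝕜 X =>
      RCLike.re (F ((ξ : StrongDual 𝕜 X).smulRight (dualVec e ξ)))) μ := by
    refine DualBall.integrable_of_continuous μ (RCLike.continuous_re.comp (F.continuous.comp ?_))
    have h3 : Continuous fun ξ : DualBall 𝕜 X => dualVec e (ξ : StrongDual 𝕜 X) :=
      continuous_finsetSum _ fun i _ =>
        (RCLike.continuous_conj.comp (DualBall.continuous_apply (e i))).smul continuous_const
    exact ((ContinuousLinearMap.smulRightL 𝕜 X X).continuous.comp continuous_subtype_val).clm_apply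
      h3
  have hmono := integral_mono hi2 hi1 hle
  rw [← hid] at hmono
  refine ⟨hmono.trans h1, fun h => ?_⟩
  obtain ⟨h3, h4⟩ := h2 (h.trans hmono)
  refine ⟨e, fun i j => ?_, ?_, h4⟩
  · rw [he, h3 i]; simp
  -- Equal integrals of two pointwise comparable functions: the domination is an equality at almost
  -- every ξ.
  · have h5 := (integral_eq_iff_of_ae_le hi2 hi1 (Filter.Eventually.of_forall hle)).mp
      (hid.symm.trans (le_antisymm hmono (h1.trans h)))
    filter_upwards [h5] with ξ hξ
    simp_rw [apply_dualVec]
    exact hξ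

end IsotropicBasis

/-! ### Extremal measures live on finitely many equiangular lines -/

section Representatives

variable {𝕜 : Type} [RCLike 𝕜] {n : ℕ} {Ω : Type*} [MeasurableSpace Ω] {μ : Measure Ω}
  [IsProbabilityMeasure μ] {x : Ω → EuclideanSpace 𝕜 (Fin n)}

lemma exists_smul_eq_of_norm_inner_eq {E : Type*} [NormedAddCommGroup E] [InnerProductSpace 𝕜 E]
    {N : ℝ} (hN : 0 < N) {u v : E} (hu : ‖u‖ ^ 2 = N) (hv : ‖v‖ ^ 2 = N)
    (h : ‖inner 𝕜 u v‖ = N) : ∃ θ : 𝕜, ‖θ‖ = 1 ∧ v = θ • u := by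
  have huv : ‖u‖ = ‖v‖ :=
    (pow_left_inj₀ (norm_nonneg _) (norm_nonneg _) two_ne_zero).mp (hu.trans hv.symm)
  have hu0 : u ≠ 0 := by rintro rfl; simp at hu; exact hN.ne hu
  have hv0 : v ≠ 0 := by rintro rfl; simp at hv; exact hN.ne hv
  have h1 : ‖inner 𝕜 u v‖ = ‖u‖ * ‖v‖ := by rw [h, ← hu, ← huv, sq]
  obtain ⟨θ, hθ, rfl⟩ := (norm_inner_eq_norm_iff hu0 hv0).mp h1
  refine ⟨θ, ?_, rfl⟩
  rw [norm_smul] at huv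
  have : 0 < ‖u‖ := norm_pos_iff.mpr hu0
  exact (mul_eq_right₀ this.ne').mp huv.symm

variable {t : ℝ} {d : ℕ}

/-- Testing isotropy on y = x ω₀ gives n = (tn)² + (n² - (tn)²) μ(C) for the class C of points
parallel to it, and the Welch relation solves this to μ(C) = 1/d. -/
lemma mul_measureReal_parallel_eq_one (hn : 0 < n) (hx : Measurable x)
    (hd : (d : ℝ) * (1 - n * t ^ 2) = n * (1 - t ^ 2)) (ht1 : n * t ^ 2 < 1)
    (hiso : ∀ y, ∫ ω, ‖inner 𝕜 (x ω) y‖ ^ 2 ∂μ = ‖y‖ ^ 2) {ω₀ : Ω} (h0 : ‖x ω₀‖ ^ 2 = n)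
    (h : ∀ᵐ ω ∂μ, ‖inner 𝕜 (x ω₀) (x ω)‖ = t * n ∨ ‖inner 𝕜 (x ω₀) (x ω)‖ = n) :
    d * μ.real {ω | ‖inner 𝕜 (x ω₀) (x ω)‖ = n} = 1 := by
  set C := {ω | ‖inner 𝕜 (x ω₀) (x ω)‖ = n} with hC
  have hCm : MeasurableSet C := (measurable_const.inner hx).norm (measurableSet_singleton _)
  have h1 := hiso (x ω₀)
  have h2 : ∫ ω, ‖inner 𝕜 (x ω) (x ω₀)‖ ^ 2 ∂μ =
      ∫ ω, ((t * n) ^ 2 + C.indicator (fun _ => (n : ℝ) ^ 2 - (t * n) ^ 2) ω) ∂μ := by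
    refine integral_congr_ae ?_
    filter_upwards [h] with ω hω
    rw [norm_inner_symm]
    by_cases hmem : ω ∈ C
    · rw [Set.indicator_of_mem hmem, show ‖inner 𝕜 (x ω₀) (x ω)‖ = n from hmem]
      ring
    · rw [Set.indicator_of_notMem hmem, hω.resolve_right hmem, add_zero]
  rw [h2, integral_add (integrable_const _) ((integrable_const _).indicator hCm),
    integral_indicator_const _ hCm, h0] at h1
  simp only [integral_const, probReal_univ, smul_eq_mul, one_mul] at h1
  have hn' : (0 : ℝ) < n := by exact_mod_cast hn
  have h3 : (n : ℝ) * (1 - n * t ^ 2) * (d * μ.real C - 1) = 0 := by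
    linear_combination h1 + n * μ.real C * hd
  have h4 : (n : ℝ) * (1 - n * t ^ 2) ≠ 0 := (mul_pos hn' (by linarith)).ne'
  have := (mul_eq_zero.mp h3).resolve_left h4
  linarith

/-- An isotropic measure for which almost all pairs are parallel or equiangular lives on
`d` lines, all of which have the same mass. -/
theorem exists_representatives (hn : 0 < n) (hx : Measurable x) (ht : 0 < t) (ht1 : t < 1)
    (hd : (d : ℝ) * (1 - n * t ^ 2) = n * (1 - t ^ 2)) (ht2 : n * t ^ 2 < 1)
    (hiso : ∀ y, ∫ ω, ‖inner 𝕜 (x ω) y‖ ^ 2 ∂μ = ‖y‖ ^ 2)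
    (hP : ∀ᵐ p ∂(μ.prod μ), ‖x p.1‖ * ‖x p.2‖ = n ∧
      (‖inner 𝕜 (x p.1) (x p.2)‖ = t * n ∨ ‖inner 𝕜 (x p.1) (x p.2)‖ = n))
    {G : Ω → Prop} (hG : ∀ᵐ ω ∂μ, G ω) :
    ∃ r : Fin d → Ω, (∀ i, ‖x (r i)‖ ^ 2 = n) ∧ (∀ i, G (r i)) ∧
      (∀ i j, i ≠ j → ‖inner 𝕜 (x (r i)) (x (r j))‖ = t * n) ∧
      ∀ {V : Type} [NormedAddCommGroup V] [NormedSpace ℝ V] [CompleteSpace V] (f : Ω → V),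
        (∀ ω i, ∀ θ : 𝕜, ‖θ‖ = 1 → x ω = θ • x (r i) → f ω = f (r i)) →
        ∫ ω, f ω ∂μ = (d : ℝ)⁻¹ • ∑ i, f (r i) := by
  have hn' : (0 : ℝ) < n := by exact_mod_cast hn
  have hP' := Measure.ae_ae_of_ae_prod hP
  -- Since almost all products of two lengths equal n, the length is almost surely constant, and its
  -- square is n.
  have hnorm : ∀ᵐ ω ∂μ, ‖x ω‖ ^ 2 = n := by
    obtain ⟨ω₀, h0⟩ := hP'.exists
    have hne : ‖x ω₀‖ ≠ 0 := by
      obtain ⟨ω, h1, -⟩ := h0.exists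
      intro h; simp only [h, zero_mul] at h1; exact hn'.ne h1
    have hc : ∀ᵐ ω ∂μ, ‖x ω‖ = n / ‖x ω₀‖ := by
      filter_upwards [h0] with ω hω
      rw [eq_div_iff hne, mul_comm]; exact hω.1
    filter_upwards [hc, hP'] with ω h1 h2
    obtain ⟨ω', h3, h4⟩ := (hc.and h2).exists
    have h5 : ‖x ω‖ * ‖x ω'‖ = n := h4.1
    rw [sq, ← h5, h3, h1]
  have hA : ∀ᵐ ω ∂μ, ‖x ω‖ ^ 2 = n ∧ G ω ∧
      ∀ᵐ ω' ∂μ, ‖inner 𝕜 (x ω) (x ω')‖ = t * n ∨ ‖inner 𝕜 (x ω) (x ω')‖ = n := by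
    filter_upwards [hnorm, hG, hP'] with ω h1 h2 h3
    exact ⟨h1, h2, h3.mono fun _ h => h.2⟩
  set C : Ω → Set Ω := fun ω₀ => {ω | ‖inner 𝕜 (x ω₀) (x ω)‖ = n} with hC
  have hCm : ∀ ω₀, MeasurableSet (C ω₀) := fun ω₀ =>
    (measurable_const.inner hx).norm (measurableSet_singleton _)
  have hone : ∀ S, MeasurableSet S → (μ.real S = 1 ↔ ∀ᵐ ω ∂μ, ω ∈ S) := fun S hS => by
    rw [measureReal_def, ENNReal.toReal_eq_one_iff]
    exact (mem_ae_iff_prob_eq_one hS).symm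
  have hd0 : (0 : ℝ) < d := by
    obtain ⟨ω, h1, h2, h3⟩ := hA.exists
    have := mul_measureReal_parallel_eq_one hn hx hd ht2 hiso h1 h3
    by_contra! h
    nlinarith [measureReal_nonneg (μ := μ) (s := {ω' | ‖inner 𝕜 (x ω) (x ω')‖ = n})]
  -- Greedy choice: k < d parallel classes of mass 1/d do not fill the space, so a generic point
  -- outside them can be added.
  have build : ∀ k ≤ d, ∃ r : Fin k → Ω, (∀ i, ‖x (r i)‖ ^ 2 = n ∧ G (r i) ∧
      ∀ᵐ ω' ∂μ, ‖inner 𝕜 (x (r i)) (x ω')‖ = t * n ∨ ‖inner 𝕜 (x (r i)) (x ω')‖ = n) ∧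
      ∀ i j, i ≠ j → ‖inner 𝕜 (x (r i)) (x (r j))‖ = t * n := by
    intro k
    induction k with
    | zero => exact fun _ => ⟨Fin.elim0, fun i => i.elim0, fun i => i.elim0⟩
    | succ k ih =>
      intro hk
      obtain ⟨r, hr1, hr2⟩ := ih (by omega)
      have hlt : μ.real (⋃ i, C (r i)) < 1 := by
        refine (measureReal_iUnion_fintype_le _).trans_lt ?_
        have h1 : ∀ i, μ.real (C (r i)) = (d : ℝ)⁻¹ := fun i =>
          eq_inv_of_mul_eq_one_right
            (mul_measureReal_parallel_eq_one hn hx hd ht2 hiso (hr1 i).1 (hr1 i).2.2)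
        simp only [h1, Finset.sum_const, Finset.card_univ, Fintype.card_fin, nsmul_eq_mul]
        rw [← div_eq_mul_inv, div_lt_one hd0]
        exact_mod_cast hk
      have hfr : ∃ᵐ ω ∂μ, ω ∉ ⋃ i, C (r i) := by
        intro hall
        have h2 : ∀ᵐ ω ∂μ, ω ∈ ⋃ i, C (r i) := hall.mono fun ω h => not_not.mp h
        exact hlt.ne ((hone _ (MeasurableSet.iUnion fun i => hCm _)).mpr h2)
      have hall : ∀ᵐ ω ∂μ, ∀ i, ‖inner 𝕜 (x (r i)) (x ω)‖ = t * n ∨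
          ‖inner 𝕜 (x (r i)) (x ω)‖ = n := ae_all_iff.mpr fun i => (hr1 i).2.2
      obtain ⟨ω, h1, h2, h3⟩ := (hfr.and_eventually (hall.and hA)).exists
      have h4 : ∀ i, ‖inner 𝕜 (x (r i)) (x ω)‖ = t * n := fun i =>
        (h2 i).resolve_right fun h => h1 (Set.mem_iUnion.mpr ⟨i, h⟩)
      refine ⟨Fin.snoc r ω, fun i => ?_, fun i j => ?_⟩
      · refine Fin.lastCases ?_ (fun i => ?_) i
        · simpa using h3
        · simpa using hr1 i
      · refine Fin.lastCases ?_ (fun i => ?_) i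
        · refine Fin.lastCases ?_ (fun j => ?_) j
          · simp
          · intro _
            simp only [Fin.snoc_last, Fin.snoc_castSucc]
            rw [norm_inner_symm]; exact h4 j
        · refine Fin.lastCases ?_ (fun j => ?_) j
          · intro _
            simpa using h4 i
          · intro hij
            simpa using hr2 i j (by rintro rfl; exact hij rfl)
  obtain ⟨r, hr1, hr2⟩ := build d le_rfl
  refine ⟨r, fun i => (hr1 i).1, fun i => (hr1 i).2.1, hr2, ?_⟩
  have hmass : ∀ i, μ.real (C (r i)) = (d : ℝ)⁻¹ := fun i =>
    eq_inv_of_mul_eq_one_right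
      (mul_measureReal_parallel_eq_one hn hx hd ht2 hiso (hr1 i).1 (hr1 i).2.2)
  have hpar : ∀ ω i, ‖x ω‖ ^ 2 = n → ω ∈ C (r i) → ∃ θ : 𝕜, ‖θ‖ = 1 ∧ x ω = θ • x (r i) :=
    fun ω i h1 h2 => exists_smul_eq_of_norm_inner_eq hn' (hr1 i).1 h1 h2
  have hdisj : ∀ ω i j, ‖x ω‖ ^ 2 = n → ω ∈ C (r i) → ω ∈ C (r j) → i = j := by
    intro ω i j h1 h2 h3
    by_contra hij
    obtain ⟨θ, hθ, hx'⟩ := hpar ω i h1 h2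
    have h4 := hr2 i j hij
    have h5 : ‖inner 𝕜 (x (r j)) (x ω)‖ = n := h3
    rw [hx', inner_smul_right, norm_mul, hθ, one_mul, norm_inner_symm, h4] at h5
    nlinarith
  have hcover : ∀ᵐ ω ∂μ, ∃ i, ω ∈ C (r i) := by
    have h1 : μ.real (⋃ i ∈ Finset.univ, C (r i)) = 1 := by
      rw [measureReal_biUnion_finset₀ (fun i _ j _ hij => ?_)
        (fun i _ => (hCm _).nullMeasurableSet)]
      · simp [hmass, hd0.ne']
      · refine measure_eq_zero_iff_ae_notMem.mpr ?_
        filter_upwards [hnorm] with ω hω h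
        exact hij (hdisj ω i j hω h.1 h.2)
    simp only [Finset.mem_univ, Set.iUnion_true] at h1
    have h2 := (hone _ (MeasurableSet.iUnion fun i => hCm _)).mp h1
    exact h2.mono fun ω h => Set.mem_iUnion.mp h
  intro V _ _ _ f hf
  have hae : f =ᵐ[μ] fun ω => ∑ i, (C (r i)).indicator (fun _ => f (r i)) ω := by
    filter_upwards [hnorm, hcover] with ω h1 ⟨i, hi⟩
    rw [Finset.sum_eq_single i (fun j _ hji => Set.indicator_of_notMem
      (fun hj => hji (hdisj ω j i h1 hj hi)) _) (by simp), Set.indicator_of_mem hi]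
    obtain ⟨θ, hθ, hx'⟩ := hpar ω i h1 hi
    exact hf ω i θ hθ hx'
  rw [integral_congr_ae hae, integral_finsetSum _ fun i _ =>
    (integrable_const _).indicator (hCm _)]
  simp only [integral_indicator_const _ (hCm _), hmass, Finset.smul_sum]

end Representatives

/-! ### Sums of signs and first-order expansions -/

section SignSums

variable {𝕜 : Type} [RCLike 𝕜] {n : ℕ}

/-- The sign of z j is z j/(ta) except at j = k, so the weighted sum hs determines the sign sum up
to one correction term. The total factor is (d/n)/t + 1 - 1/t = dδ/n. -/
lemma sum_sign_mul_eq (hn : 1 ≤ n) {ι : Type*} [Fintype ι] {z g : ι → 𝕜} {k : ι} {a : ℝ}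
    (ha : 0 < a) (hk : z k = a) (hz : ∀ j, j ≠ k → ‖z j‖ = etfAngle 𝕜 n * a)
    (hs : ∑ j, z j * g j = ((gerzonBound 𝕜 n / n * a : ℝ) : 𝕜) * g k) :
    ∑ j, z j / (‖z j‖ : 𝕜) * g j = ((gerzonBound 𝕜 n * deltaConst 𝕜 n / n : ℝ) : 𝕜) * g k := by
  classical
  have ht := etfAngle_pos 𝕜 (n := n)
  have h1 : ∀ j, z j / (‖z j‖ : 𝕜) * g j = (((etfAngle 𝕜 n * a)⁻¹ : ℝ) : 𝕜) * (z j * g j) +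
      if j = k then ((1 - (etfAngle 𝕜 n)⁻¹ : ℝ) : 𝕜) * g j else 0 := by
    intro j
    split_ifs with hj
    · subst hj
      have ha' : (a : 𝕜) ≠ 0 := by exact_mod_cast ha.ne'
      have ht' : (etfAngle 𝕜 n : 𝕜) ≠ 0 := by exact_mod_cast ht.ne'
      rw [hk, RCLike.norm_ofReal, abs_of_pos ha]
      push_cast
      field_simp
      ring
    · rw [hz j hj, add_zero]
      push_cast
      rw [div_eq_mul_inv]
      ring
  simp_rw [h1]
  rw [Finset.sum_add_distrib, ← Finset.mul_sum, hs, Finset.sum_ite_eq' Finset.univ k,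
    if_pos (Finset.mem_univ k), gerzonBound_mul_deltaConst_div 𝕜 hn]
  rw [← mul_assoc, ← RCLike.ofReal_mul, ← add_mul, ← RCLike.ofReal_add]
  congr 2
  field_simp
  ring

/-- The bound 2‖z‖‖z + su‖ ≤ ‖z‖² + ‖z + su‖² gives the first-order expansion of the modulus with an
explicit quadratic error. -/
lemma norm_add_smul_le {z : 𝕜} (hz : z ≠ 0) (u : 𝕜) (s : ℝ) :
    ‖z + (s : 𝕜) * u‖ ≤ ‖z‖ + s * RCLike.re (starRingEnd 𝕜 z / (‖z‖ : 𝕜) * u)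
      + s ^ 2 * (‖u‖ ^ 2 / (2 * ‖z‖)) := by
  have hz' : 0 < ‖z‖ := norm_pos_iff.mpr hz
  have h1 : ‖z + (s : 𝕜) * u‖ ^ 2 = ‖z‖ ^ 2 + 2 * s * RCLike.re (starRingEnd 𝕜 z * u)
      + s ^ 2 * ‖u‖ ^ 2 := by
    simp only [← RCLike.normSq_eq_def', RCLike.normSq_apply]
    simp
    ring
  have h2 : RCLike.re (starRingEnd 𝕜 z / (‖z‖ : 𝕜) * u) =
      RCLike.re (starRingEnd 𝕜 z * u) / ‖z‖ := by
    rw [div_mul_eq_mul_div, RCLike.div_re_ofReal]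
  rw [h2]
  have h3 : 2 * ‖z‖ * ‖z + (s : 𝕜) * u‖ ≤ 2 * ‖z‖ * (‖z‖ + s *
      (RCLike.re (starRingEnd 𝕜 z * u) / ‖z‖) + s ^ 2 * (‖u‖ ^ 2 / (2 * ‖z‖))) := by
    have h4 : 2 * ‖z‖ * (‖z‖ + s * (RCLike.re (starRingEnd 𝕜 z * u) / ‖z‖)
        + s ^ 2 * (‖u‖ ^ 2 / (2 * ‖z‖))) = ‖z‖ ^ 2 + ‖z + (s : 𝕜) * u‖ ^ 2 := by
      rw [h1]; field_simp; ring
    rw [h4]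
    nlinarith [sq_nonneg (‖z‖ - ‖z + (s : 𝕜) * u‖)]
  exact le_of_mul_le_mul_left h3 (by positivity)

lemma eq_zero_of_forall_nonneg {A B : ℝ} (h : ∀ s : ℝ, 0 ≤ s * A + s ^ 2 * B) : A = 0 := by
  have h1 := h (-A / (|B| + 1))
  have hB : 0 < |B| + 1 := by positivity
  have h2 : -A / (|B| + 1) * A + (-A / (|B| + 1)) ^ 2 * B =
      A ^ 2 / (|B| + 1) ^ 2 * (B - |B| - 1) := by
    field_simp
    ring
  rw [h2] at h1
  by_contra hA
  have h3 : 0 < A ^ 2 / (|B| + 1) ^ 2 := by positivity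
  nlinarith [le_abs_self B]

end SignSums

/-! ### Maximal equiangular tight frames -/

section Frames

variable {𝕜 : Type} [RCLike 𝕜] {n : ℕ}
  {w : Fin (gerzonBound 𝕜 n) → EuclideanSpace 𝕜 (Fin n)}

/-- The trace of the frame identity reads n = αd, which determines α. -/
lemma IsMaximalETF.sum_inner_smul (hn : 1 ≤ n) (hw : IsMaximalETF w)
    (x : EuclideanSpace 𝕜 (Fin n)) :
    ∑ i, inner 𝕜 (w i) x • w i = ((gerzonBound 𝕜 n / n : ℝ) : 𝕜) • x := by
  obtain ⟨⟨-, hw1, -⟩, α, hα⟩ := hw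
  have hn' : (n : 𝕜) ≠ 0 := by exact_mod_cast (by omega : n ≠ 0)
  have h1 : (n : 𝕜) = α * gerzonBound 𝕜 n := by
    have h2 : ∀ j : Fin n, (1 : 𝕜) = α * ∑ i, starRingEnd 𝕜 (w i j) * w i j := by
      intro j
      have := congrArg (fun v : EuclideanSpace 𝕜 (Fin n) => v j)
        (hα (EuclideanSpace.single j 1))
      simpa [EuclideanSpace.inner_single_right] using this
    calc (n : 𝕜) = ∑ _j : Fin n, (1 : 𝕜) := by simp
      _ = ∑ j, α * ∑ i, starRingEnd 𝕜 (w i j) * w i j := Finset.sum_congr rfl fun j _ => h2 j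
      _ = α * ∑ i, ∑ j, starRingEnd 𝕜 (w i j) * w i j := by
        rw [← Finset.mul_sum, Finset.sum_comm]
      _ = α * ∑ i, (1 : 𝕜) := by
        congr 1
        refine Finset.sum_congr rfl fun i _ => ?_
        have h3 : inner 𝕜 (w i) (w i) = (1 : 𝕜) := by
          rw [inner_self_eq_norm_sq_to_K, hw1]; simp
        rw [PiLp.inner_apply] at h3
        simp only [RCLike.inner_apply] at h3
        rw [← h3]
        exact Finset.sum_congr rfl fun j _ => mul_comm _ _
      _ = _ := by simp
  have hα0 : α ≠ 0 := by rintro rfl; simp at h1; exact hn' (by exact_mod_cast h1)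
  have h4 : ((gerzonBound 𝕜 n / n : ℝ) : 𝕜) = α⁻¹ := by
    push_cast
    rw [h1]
    have hd : (gerzonBound 𝕜 n : 𝕜) ≠ 0 := by exact_mod_cast (gerzonBound_pos 𝕜 hn).ne'
    field_simp
  rw [h4]
  conv_rhs => rw [hα x]
  rw [smul_smul, inv_mul_cancel₀ hα0, one_smul]

/-- The frame identity at w i, paired with w i, gives d/n = 1 + (d - 1)c². By the Welch relation and
d ≥ 2 this leaves only c = t. -/
lemma IsMaximalETF.norm_inner (hn : 1 ≤ n) (hw : IsMaximalETF w) {i j : Fin (gerzonBound 𝕜 n)}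
    (hij : i ≠ j) : ‖inner 𝕜 (w i) (w j)‖ = etfAngle 𝕜 n := by
  have hf := hw.sum_inner_smul hn (w i)
  obtain ⟨⟨-, hw1, c, hc⟩, -⟩ := hw
  have ht := etfAngle_pos 𝕜 (n := n)
  have hn' : (0 : ℝ) < n := by exact_mod_cast hn
  have hd2 : (2 : ℝ) ≤ gerzonBound 𝕜 n := by
    have h1 := i.2
    have h2 := j.2
    have h3 : (i : ℕ) ≠ j := fun h => hij (Fin.ext h)
    exact_mod_cast (by omega : 2 ≤ gerzonBound 𝕜 n)
  have h1 := congrArg (fun v => RCLike.re (inner 𝕜 (w i) v)) hf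
  simp only [inner_sum, inner_smul_right, map_sum] at h1
  have h2 : ∀ k, RCLike.re (inner 𝕜 (w k) (w i) * inner 𝕜 (w i) (w k)) =
      c ^ 2 + if k = i then 1 - c ^ 2 else 0 := by
    intro k
    rw [← inner_conj_symm (w k) (w i), RCLike.conj_mul]
    rw [← RCLike.ofReal_pow, RCLike.ofReal_re]
    split_ifs with hk
    · rw [hk, inner_self_eq_norm_sq_to_K, hw1]; simp
    · rw [hc i k (Ne.symm hk), add_zero]
  simp only [h2, Finset.sum_add_distrib, Finset.sum_const, Finset.card_univ, Fintype.card_fin,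
    nsmul_eq_mul, Finset.sum_ite_eq', Finset.mem_univ, if_true, inner_self_eq_norm_sq_to_K, hw1,
    RCLike.re_ofReal_mul] at h1
  simp only [RCLike.ofReal_one, one_pow, RCLike.one_re, mul_one] at h1
  have h3 := gerzonBound_mul 𝕜 (n := n)
  have h1' : (gerzonBound 𝕜 n * c ^ 2 + (1 - c ^ 2)) * n = (gerzonBound 𝕜 n : ℝ) := by
    rw [h1]; field_simp
  have h4 : ((gerzonBound 𝕜 n : ℝ) - 1) * n * (c ^ 2 - etfAngle 𝕜 n ^ 2) = 0 := by
    linear_combination h1' + h3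
  have h5 : ((gerzonBound 𝕜 n : ℝ) - 1) * n ≠ 0 :=
    (mul_pos (by linarith) hn').ne'
  have h6 := (mul_eq_zero.mp h4).resolve_left h5
  have hc0 : 0 ≤ c := by rw [← hc i j hij]; exact norm_nonneg _
  rw [hc i j hij]
  exact (pow_left_inj₀ hc0 ht.le two_ne_zero).mp (by linarith)

/-- The vector (dδ/n) w i is a sum of the w j with coefficients of modulus at most 1, namely the
signs of ⟨w j, w i⟩. Thus (dδ/n) ⟨w i, ·⟩ has norm at most 1 for the norm ∑ |⟨w j, ·⟩|. -/
lemma IsMaximalETF.mul_norm_inner_le (hn : 1 ≤ n) (hw : IsMaximalETF w)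
    (i : Fin (gerzonBound 𝕜 n)) (y : EuclideanSpace 𝕜 (Fin n)) :
    gerzonBound 𝕜 n * deltaConst 𝕜 n / n * ‖inner 𝕜 (w i) y‖ ≤ ∑ j, ‖inner 𝕜 (w j) y‖ := by
  have hn' : (0 : ℝ) < n := by exact_mod_cast hn
  have h1 := sum_sign_mul_eq (𝕜 := 𝕜) hn (z := fun j => inner 𝕜 (w j) (w i))
    (g := fun j => inner 𝕜 y (w j)) (k := i) (a := 1) one_pos
    (by simp [inner_self_eq_norm_sq_to_K, hw.1.2.1 i])
    (fun j hj => by rw [hw.norm_inner hn hj, mul_one])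
    (by
      have := congrArg (fun v => inner 𝕜 y v) (hw.sum_inner_smul hn (w i))
      simp only [inner_sum, inner_smul_right] at this
      rw [this, mul_one])
  have hδ := deltaConst_pos 𝕜 hn
  have h2 := congrArg norm h1
  rw [norm_mul, RCLike.norm_ofReal, abs_of_nonneg (by positivity), norm_inner_symm y] at h2
  rw [← h2]
  refine (norm_sum_le _ _).trans (Finset.sum_le_sum fun j _ => ?_)
  rw [norm_mul, norm_inner_symm y]
  refine mul_le_of_le_one_left (norm_nonneg _) ?_
  rw [norm_div, RCLike.norm_ofReal, abs_norm]
  exact div_self_le_one _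

end Frames

/-! ### The two bounds for the absolute projection constant -/

section Bounds

variable {𝕜 : Type} [RCLike 𝕜] {n : ℕ} {X : Type u} [NormedAddCommGroup X] [NormedSpace 𝕜 X]
  [FiniteDimensional 𝕜 X]

/-- The König–Tomczak-Jaegermann bound. -/
theorem absProjConst_le (hn : 1 ≤ n) (hX : Module.finrank 𝕜 X = n) :
    absProjConst 𝕜 X ≤ ENNReal.ofReal (deltaConst 𝕜 n) := by
  by_contra! hlt
  obtain ⟨r, hr0, hr1, hr2⟩ := ENNReal.lt_iff_exists_real_btwn.mp hlt
  have hδr : deltaConst 𝕜 n < r := by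
    by_contra! h
    exact absurd (ENNReal.ofReal_le_ofReal h) (not_le.mpr hr1)
  -- For r strictly between δ and λ(X), a factorization with constant below r contradicts r < λ(X),
  -- and its absence yields a trace functional of size at least r > δ.
  by_cases hmem : (ContinuousLinearMap.id 𝕜 X, ContinuousMap.const _ r) ∈ factorCone 𝕜 X
  · obtain ⟨M, -, hM, hle⟩ := absProjConst_lt_of_mem_factorCone hmem
    exact absurd (hle.trans (ENNReal.ofReal_le_ofReal hM.le)) (not_le.mpr hr2)
  · obtain ⟨F, μ, _, hM, hF⟩ := exists_functional_of_notMem_factorCone hmem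
    have := (re_apply_id_le hn hX hF).1
    linarith

theorem deltaConst_le_absProjConst (hn : 1 ≤ n) (hX : Module.finrank 𝕜 X = n)
    {ξ : Fin (gerzonBound 𝕜 n) → StrongDual 𝕜 X} (hξ : ∀ i, ‖ξ i‖ ≤ 1)
    (h : ∀ s : StrongDual 𝕜 X, ‖s‖ ≤ 1 → ∃ a : Fin (gerzonBound 𝕜 n) → 𝕜, (∀ i, ‖a i‖ ≤ 1) ∧
      s = ((n / (gerzonBound 𝕜 n * deltaConst 𝕜 n) : ℝ) : 𝕜) • ∑ i, a i • ξ i) :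
    ENNReal.ofReal (deltaConst 𝕜 n) ≤ absProjConst 𝕜 X := by
  have hδ := deltaConst_pos 𝕜 hn
  have hn' : (0 : ℝ) < n := by exact_mod_cast hn
  have hd : (0 : ℝ) < gerzonBound 𝕜 n := by exact_mod_cast gerzonBound_pos 𝕜 hn
  refine le_absProjConst hξ (by positivity) (fun p hp => ?_) h
  rw [hX] at hp
  have h1 : (n : ℝ) / (gerzonBound 𝕜 n * deltaConst 𝕜 n) * gerzonBound 𝕜 n * p =
      n * (p / deltaConst 𝕜 n) := by field_simp
  rw [h1] at hp
  have := (le_mul_iff_one_le_right hn').mp hp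
  rwa [one_le_div hδ] at this

end Bounds

/-! ### Spaces of extremal projection constant: the functionals of contact -/

section Extremal

variable {𝕜 : Type} [RCLike 𝕜] {n : ℕ} {X : Type u} [NormedAddCommGroup X] [NormedSpace 𝕜 X]

lemma dualCoords_injective (e : Module.Basis (Fin n) 𝕜 X) :
    Function.Injective (dualCoords e) := by
  intro s s' h
  have h1 : (s : X →ₗ[𝕜] 𝕜) = s' := e.ext fun i => congrArg (fun v => v i) h
  ext y
  exact LinearMap.congr_fun h1 y

/-- A factorization with bound δ would make λ(X) strictly smaller than δ, so the dual functional
exists with M = δ and every estimate is tight. The integrands in play are invariant under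
multiplying η by a phase, so μ acts on them as the uniform average over d functionals. -/
theorem exists_extremal_functionals [FiniteDimensional 𝕜 X] (hn : 1 ≤ n) (hX : Module.finrank 𝕜 X = n)
    (h : absProjConst 𝕜 X = ENNReal.ofReal (deltaConst 𝕜 n)) :
    ∃ (F : StrongDual 𝕜 (X →L[𝕜] X)) (e : Module.Basis (Fin n) 𝕜 X)
      (r : Fin (gerzonBound 𝕜 n) → DualBall 𝕜 X),
      (∀ i, ‖dualCoords e (r i : StrongDual 𝕜 X)‖ ^ 2 = n) ∧
      (∀ i j, i ≠ j → ‖inner 𝕜 (dualCoords e (r i : StrongDual 𝕜 X))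
        (dualCoords e (r j : StrongDual 𝕜 X))‖ = etfAngle 𝕜 n * n) ∧
      (∀ y, ∑ k, inner 𝕜 (dualCoords e (r k : StrongDual 𝕜 X)) y •
        dualCoords e (r k : StrongDual 𝕜 X) = (gerzonBound 𝕜 n : 𝕜) • y) ∧
      (∀ (s : DualBall 𝕜 X) (b : X), RCLike.re (F ((s : StrongDual 𝕜 X).smulRight b)) ≤
        (gerzonBound 𝕜 n : ℝ)⁻¹ * ∑ j, ‖(r j : StrongDual 𝕜 X) b‖) ∧
      ∀ k, RCLike.re (F ((r k : StrongDual 𝕜 X).smulRight (dualVec e (r k)))) =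
        (gerzonBound 𝕜 n : ℝ)⁻¹ * ∑ j, ‖(r j : StrongDual 𝕜 X) (dualVec e (r k))‖ := by
  have hd : (gerzonBound 𝕜 n : 𝕜) ≠ 0 := by exact_mod_cast (gerzonBound_pos 𝕜 hn).ne'
  have hmem : (ContinuousLinearMap.id 𝕜 X, ContinuousMap.const _ (deltaConst 𝕜 n)) ∉
      factorCone 𝕜 X := by
    intro hmem
    obtain ⟨M, -, hM, hle⟩ := absProjConst_lt_of_mem_factorCone hmem
    rw [h, ENNReal.ofReal_le_ofReal_iff'] at hle
    have := deltaConst_pos 𝕜 hn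
    rcases hle with h1 | h1 <;> linarith
  obtain ⟨F, μ, _, hM, hF⟩ := exists_functional_of_notMem_factorCone hmem
  obtain ⟨e, he, hG, hP⟩ := (re_apply_id_le hn hX hF).2 hM
  have hiso : ∀ y : EuclideanSpace 𝕜 (Fin n),
      ∫ η : DualBall 𝕜 X, ‖inner 𝕜 (dualCoords e (η : StrongDual 𝕜 X)) y‖ ^ 2 ∂μ = ‖y‖ ^ 2 := by
    intro y
    rw [integral_norm_inner_sq (ε := fun _ => 1) (by simpa using he), EuclideanSpace.norm_sq_eq]
    simp
  obtain ⟨r, hr1, hr2, hr3, hr4⟩ := exists_representatives hn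
    (continuous_dualCoords e).measurable (etfAngle_pos 𝕜) (etfAngle_lt_one 𝕜 hn)
    (gerzonBound_mul 𝕜) (mul_etfAngle_sq_lt_one 𝕜) hiso hP hG
  have hr5 : ∀ (ω : DualBall 𝕜 X) (i : Fin (gerzonBound 𝕜 n)) (θ : 𝕜),
      dualCoords e (ω : StrongDual 𝕜 X) = θ • dualCoords e (r i : StrongDual 𝕜 X) →
      (ω : StrongDual 𝕜 X) = θ • (r i : StrongDual 𝕜 X) := fun ω i θ hω =>
    dualCoords_injective e (by rw [hω, map_smul])
  have hN : ∀ b : X, ∫ η : DualBall 𝕜 X, ‖(η : StrongDual 𝕜 X) b‖ ∂μ =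
      (gerzonBound 𝕜 n : ℝ)⁻¹ * ∑ j, ‖(r j : StrongDual 𝕜 X) b‖ := by
    intro b
    refine hr4 (fun η => ‖(η : StrongDual 𝕜 X) b‖) fun ω i θ hθ hω => ?_
    simp only [hr5 ω i θ hω]
    simp [hθ]
  refine ⟨F, e, r, hr1, hr3, fun y => ?_, fun s b => hN b ▸ hF s b, fun k => hN _ ▸ hr2 k⟩
  have hm : ∀ i j, ∑ k, starRingEnd 𝕜 ((r k : StrongDual 𝕜 X) (e i)) *
      (r k : StrongDual 𝕜 X) (e j) = if i = j then (gerzonBound 𝕜 n : 𝕜) else 0 := by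
    intro i j
    have h1 := hr4 (fun η => starRingEnd 𝕜 ((η : StrongDual 𝕜 X) (e i)) *
      (η : StrongDual 𝕜 X) (e j)) fun ω i θ hθ hω => by
        simp only [hr5 ω i θ hω]
        simp only [smul_apply, smul_eq_mul, map_mul]
        rw [mul_mul_mul_comm, RCLike.conj_mul, hθ]
        simp
    rw [← momentForm_apply, he, RCLike.real_smul_eq_coe_mul] at h1
    have h2 := congrArg (fun z => (gerzonBound 𝕜 n : 𝕜) * z) h1
    simp only [RCLike.ofReal_inv, RCLike.ofReal_natCast] at h2
    rw [mul_inv_cancel_left₀ hd] at h2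
    rw [← h2]
    simp
  ext j
  have h3 : ∀ k, inner 𝕜 (dualCoords e (r k : StrongDual 𝕜 X)) y =
      ∑ i, y i * starRingEnd 𝕜 ((r k : StrongDual 𝕜 X) (e i)) := fun k => by
    simp [PiLp.inner_apply, dualCoords_apply]
  simp only [h3, WithLp.ofLp_sum, WithLp.ofLp_smul, Finset.sum_apply, Pi.smul_apply,
    dualCoords_apply, smul_eq_mul, Finset.sum_mul]
  rw [Finset.sum_comm]
  simp only [mul_assoc, ← Finset.mul_sum, hm]
  simp [mul_comm]

/-- The domination by the average of the |r j| is an equality at `dualVec` (r k), so the derivatives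
of both sides in every direction c agree there. No r j vanishes at that vector, and the derivative
of the right side is a sign sum evaluated by `sum_sign_mul_eq`. -/
lemma re_apply_smulRight_eq (hn : 1 ≤ n) {F : StrongDual 𝕜 (X →L[𝕜] X)}
    {e : Module.Basis (Fin n) 𝕜 X} {r : Fin (gerzonBound 𝕜 n) → DualBall 𝕜 X}
    (h1 : ∀ i, ‖dualCoords e (r i : StrongDual 𝕜 X)‖ ^ 2 = n)
    (h2 : ∀ i j, i ≠ j → ‖inner 𝕜 (dualCoords e (r i : StrongDual 𝕜 X))
        (dualCoords e (r j : StrongDual 𝕜 X))‖ = etfAngle 𝕜 n * n)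
    (h3 : ∀ s : StrongDual 𝕜 X, ∑ k, inner 𝕜 (dualCoords e (r k : StrongDual 𝕜 X))
      (dualCoords e s) • (r k : StrongDual 𝕜 X) = (gerzonBound 𝕜 n : 𝕜) • s)
    (h4 : ∀ (s : DualBall 𝕜 X) (b : X), RCLike.re (F ((s : StrongDual 𝕜 X).smulRight b)) ≤
        (gerzonBound 𝕜 n : ℝ)⁻¹ * ∑ j, ‖(r j : StrongDual 𝕜 X) b‖)
    (h5 : ∀ k, RCLike.re (F ((r k : StrongDual 𝕜 X).smulRight (dualVec e (r k)))) =
        (gerzonBound 𝕜 n : ℝ)⁻¹ * ∑ j, ‖(r j : StrongDual 𝕜 X) (dualVec e (r k))‖)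
    (k : Fin (gerzonBound 𝕜 n)) (c : X) :
    RCLike.re (F ((r k : StrongDual 𝕜 X).smulRight c)) =
      deltaConst 𝕜 n / n * RCLike.re ((r k : StrongDual 𝕜 X) c) := by
  have hn' : (0 : ℝ) < n := by exact_mod_cast hn
  have hd : (0 : ℝ) < gerzonBound 𝕜 n := by exact_mod_cast gerzonBound_pos 𝕜 hn
  set x := fun j => dualCoords e (r j : StrongDual 𝕜 X) with hx
  set z := fun j => inner 𝕜 (x k) (x j) with hz
  have hzr : ∀ j, (r j : StrongDual 𝕜 X) (dualVec e (r k)) = z j := fun j => apply_dualVec e _ _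
  have hkk : inner 𝕜 (x k) (x k) = ((n : ℝ) : 𝕜) := by
    rw [inner_self_eq_norm_sq_to_K, ← RCLike.ofReal_pow, h1]
  have hz0 : ∀ j, z j ≠ 0 := by
    intro j
    rcases eq_or_ne k j with rfl | hj
    · rw [hz]; simp only [hkk]; exact_mod_cast hn'.ne'
    · rw [← norm_ne_zero_iff, hz]
      simp only [hx, h2 k j hj]
      exact (mul_pos (etfAngle_pos 𝕜) hn').ne'
  have hsign := sum_sign_mul_eq (𝕜 := 𝕜) hn (z := fun j => inner 𝕜 (x j) (x k))
    (g := fun j => (r j : StrongDual 𝕜 X) c) (k := k) hn' hkk (fun j hj => h2 j k hj) (by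
      have := congrArg (fun s : StrongDual 𝕜 X => s c) (h3 (r k))
      simp only [sum_apply, smul_apply, smul_eq_mul] at this
      rw [this, div_mul_cancel₀ _ hn'.ne']
      push_cast; rfl)
  have hsign' : ∑ j, RCLike.re (starRingEnd 𝕜 (z j) / (‖z j‖ : 𝕜) * (r j : StrongDual 𝕜 X) c) =
      gerzonBound 𝕜 n * (deltaConst 𝕜 n / n * RCLike.re ((r k : StrongDual 𝕜 X) c)) := by
    have := congrArg RCLike.re hsign
    rw [RCLike.re_ofReal_mul, map_sum] at this
    rw [← mul_assoc, ← mul_div_assoc, ← this]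
    refine Finset.sum_congr rfl fun j _ => ?_
    simp only [hz, inner_conj_symm]
    rw [norm_inner_symm]
  have hlin : ∀ s : ℝ, RCLike.re (F ((r k : StrongDual 𝕜 X).smulRight
      (dualVec e (r k) + (s : 𝕜) • c))) =
      RCLike.re (F ((r k : StrongDual 𝕜 X).smulRight (dualVec e (r k)))) +
        s * RCLike.re (F ((r k : StrongDual 𝕜 X).smulRight c)) := by
    intro s
    have : (r k : StrongDual 𝕜 X).smulRight (dualVec e (r k) + (s : 𝕜) • c) =
        (r k : StrongDual 𝕜 X).smulRight (dualVec e (r k)) +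
          (s : 𝕜) • (r k : StrongDual 𝕜 X).smulRight c := by
      ext y
      simp [smul_comm (s : 𝕜)]
    rw [this, map_add, map_smul, smul_eq_mul, map_add, RCLike.re_ofReal_mul]
  have hmain := eq_zero_of_forall_nonneg
    (A := deltaConst 𝕜 n / n * RCLike.re ((r k : StrongDual 𝕜 X) c) -
      RCLike.re (F ((r k : StrongDual 𝕜 X).smulRight c)))
    (B := (gerzonBound 𝕜 n : ℝ)⁻¹ *
      ∑ j, ‖(r j : StrongDual 𝕜 X) c‖ ^ 2 / (2 * ‖z j‖)) fun s => by
    have h6 := h4 (r k) (dualVec e (r k) + (s : 𝕜) • c)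
    rw [hlin, h5] at h6
    have h7 : ∑ j, ‖(r j : StrongDual 𝕜 X) (dualVec e (r k) + (s : 𝕜) • c)‖ ≤
        ∑ j, ‖z j‖ + s * (gerzonBound 𝕜 n *
          (deltaConst 𝕜 n / n * RCLike.re ((r k : StrongDual 𝕜 X) c))) +
          s ^ 2 * ∑ j, ‖(r j : StrongDual 𝕜 X) c‖ ^ 2 / (2 * ‖z j‖) := by
      rw [← hsign', Finset.mul_sum, Finset.mul_sum, ← Finset.sum_add_distrib,
        ← Finset.sum_add_distrib]
      refine Finset.sum_le_sum fun j _ => ?_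
      rw [map_add, map_smul, smul_eq_mul, hzr]
      exact norm_add_smul_le (hz0 j) _ s
    have h8 := mul_le_mul_of_nonneg_left h7 (inv_nonneg.mpr hd.le)
    simp only [hzr] at h6
    have h9 : (gerzonBound 𝕜 n : ℝ)⁻¹ * (∑ j, ‖z j‖ + s * (gerzonBound 𝕜 n *
          (deltaConst 𝕜 n / n * RCLike.re ((r k : StrongDual 𝕜 X) c))) +
          s ^ 2 * ∑ j, ‖(r j : StrongDual 𝕜 X) c‖ ^ 2 / (2 * ‖z j‖)) =
        (gerzonBound 𝕜 n : ℝ)⁻¹ * ∑ j, ‖z j‖ +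
          s * (deltaConst 𝕜 n / n * RCLike.re ((r k : StrongDual 𝕜 X) c)) +
          s ^ 2 * ((gerzonBound 𝕜 n : ℝ)⁻¹ *
            ∑ j, ‖(r j : StrongDual 𝕜 X) c‖ ^ 2 / (2 * ‖z j‖)) := by
      field_simp
    rw [h9] at h8
    linarith
  linarith

/-- On a space of maximal projection constant the dual norm is dominated by the zonotope of the
extremal functionals. -/
lemma norm_apply_le_of_extremal (hn : 1 ≤ n) {F : StrongDual 𝕜 (X →L[𝕜] X)}
    {r : Fin (gerzonBound 𝕜 n) → DualBall 𝕜 X} {φ : StrongDual 𝕜 X → Fin (gerzonBound 𝕜 n) → 𝕜}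
    (h3 : ∀ s : StrongDual 𝕜 X, ∑ k, φ s k • (r k : StrongDual 𝕜 X) = (gerzonBound 𝕜 n : 𝕜) • s)
    (h4 : ∀ (s : DualBall 𝕜 X) (b : X), RCLike.re (F ((s : StrongDual 𝕜 X).smulRight b)) ≤
        (gerzonBound 𝕜 n : ℝ)⁻¹ * ∑ j, ‖(r j : StrongDual 𝕜 X) b‖)
    (h5 : ∀ k c, RCLike.re (F ((r k : StrongDual 𝕜 X).smulRight c)) =
      deltaConst 𝕜 n / n * RCLike.re ((r k : StrongDual 𝕜 X) c))
    (s : DualBall 𝕜 X) (c : X) :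
    ‖(s : StrongDual 𝕜 X) c‖ ≤ n / (gerzonBound 𝕜 n * deltaConst 𝕜 n) *
      ∑ j, ‖(r j : StrongDual 𝕜 X) c‖ := by
  have hn' : (0 : ℝ) < n := by exact_mod_cast hn
  have hδ := deltaConst_pos 𝕜 hn
  have hd : (0 : ℝ) < gerzonBound 𝕜 n := by exact_mod_cast gerzonBound_pos 𝕜 hn
  have hd' : (gerzonBound 𝕜 n : 𝕜) ≠ 0 := by exact_mod_cast hd.ne'
  -- The r k span the dual space, so the formula for Re F on the r k extends to every s; the scalars
  -- are moved into the vector, since only real parts are known.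
  have h6 : ∀ c : X, RCLike.re (F ((s : StrongDual 𝕜 X).smulRight c)) =
      deltaConst 𝕜 n / n * RCLike.re ((s : StrongDual 𝕜 X) c) := by
    intro c
    have h7 : (s : StrongDual 𝕜 X) = ∑ k, ((gerzonBound 𝕜 n : 𝕜)⁻¹ * φ s k) •
        (r k : StrongDual 𝕜 X) := by
      simp only [mul_smul, ← Finset.smul_sum, h3]
      rw [inv_smul_smul₀ hd']
    have h8 : (s : StrongDual 𝕜 X).smulRight c = ∑ k, (r k : StrongDual 𝕜 X).smulRight
        (((gerzonBound 𝕜 n : 𝕜)⁻¹ * φ s k) • c) := by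
      ext y
      conv_lhs => rw [h7]
      simp only [ContinuousLinearMap.smulRight_apply, sum_apply, Finset.sum_smul,
        smul_apply, smul_eq_mul]
      exact Finset.sum_congr rfl fun k _ => by rw [smul_smul, mul_comm]
    rw [h8, map_sum, map_sum]
    simp only [h5]
    rw [← Finset.mul_sum, ← map_sum]
    conv_rhs => rw [h7]
    simp [sum_apply]
  -- A rotation by a phase turns the real part of s(c) into its modulus and leaves the dominating
  -- sum unchanged.
  obtain ⟨θ, hθ, hθc⟩ : ∃ θ : 𝕜, ‖θ‖ = 1 ∧
      θ * (s : StrongDual 𝕜 X) c = (‖(s : StrongDual 𝕜 X) c‖ : 𝕜) := by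
    rcases eq_or_ne ((s : StrongDual 𝕜 X) c) 0 with h0 | h0
    · exact ⟨1, by simp, by simp [h0]⟩
    · have h0' : (‖(s : StrongDual 𝕜 X) c‖ : 𝕜) ≠ 0 := by simpa using h0
      refine ⟨(‖(s : StrongDual 𝕜 X) c‖ : 𝕜) / (s : StrongDual 𝕜 X) c, ?_,
        div_mul_cancel₀ _ h0⟩
      rw [norm_div, RCLike.norm_ofReal, abs_norm, div_self (norm_ne_zero_iff.mpr h0)]
  have h9 := h4 s (θ • c)
  rw [h6] at h9
  simp only [map_smul, smul_eq_mul, hθc, norm_mul, hθ, one_mul, RCLike.ofReal_re] at h9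
  calc ‖(s : StrongDual 𝕜 X) c‖
      = n / deltaConst 𝕜 n * (deltaConst 𝕜 n / n * ‖(s : StrongDual 𝕜 X) c‖) := by field_simp
    _ ≤ n / deltaConst 𝕜 n * ((gerzonBound 𝕜 n : ℝ)⁻¹ * ∑ j, ‖(r j : StrongDual 𝕜 X) c‖) := by
      gcongr
    _ = _ := by field_simp

end Extremal

/-! ### The characterization by maximal frames -/

section Characterization

variable {𝕜 : Type} [RCLike 𝕜] {n : ℕ} {X : Type u} [NormedAddCommGroup X] [NormedSpace 𝕜 X]

lemma mem_real_smul_zonotope_iff {w : Fin (gerzonBound 𝕜 n) → EuclideanSpace 𝕜 (Fin n)} {M : ℝ}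
    {v : EuclideanSpace 𝕜 (Fin n)} :
    v ∈ M • zonotope 𝕜 w ↔ ∃ a : Fin (gerzonBound 𝕜 n) → 𝕜, (∀ i, ‖a i‖ ≤ 1) ∧
      v = (M : 𝕜) • ∑ i, a i • w i := by
  rw [Set.mem_smul_set]
  constructor
  · rintro ⟨-, ⟨a, ha, rfl⟩, rfl⟩
    exact ⟨a, ha, RCLike.real_smul_eq_coe_smul (K := 𝕜) _ _⟩
  · rintro ⟨a, ha, rfl⟩
    exact ⟨_, ⟨a, ha, rfl⟩, RCLike.real_smul_eq_coe_smul (K := 𝕜) _ _⟩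

lemma isMaximalETF_of_norm_inner_eq (hn : 1 ≤ n)
    {x : Fin (gerzonBound 𝕜 n) → EuclideanSpace 𝕜 (Fin n)}
    (h1 : ∀ i, ‖x i‖ ^ 2 = n) (h2 : ∀ i j, i ≠ j → ‖inner 𝕜 (x i) (x j)‖ = etfAngle 𝕜 n * n)
    (h3 : ∀ y, ∑ k, inner 𝕜 (x k) y • x k = (gerzonBound 𝕜 n : 𝕜) • y) :
    IsMaximalETF fun i => (((√n)⁻¹ : ℝ) : 𝕜) • x i := by
  have hn' : (0 : ℝ) < n := by exact_mod_cast hn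
  have hsq : (√n)⁻¹ * (√n)⁻¹ * n = 1 := by
    rw [← mul_inv, Real.mul_self_sqrt hn'.le, inv_mul_cancel₀ hn'.ne']
  have hs0 : 0 ≤ (√(n : ℝ))⁻¹ := by positivity
  have hinner : ∀ i j, inner 𝕜 ((((√n)⁻¹ : ℝ) : 𝕜) • x i) ((((√n)⁻¹ : ℝ) : 𝕜) • x j) =
      (((√n)⁻¹ * (√n)⁻¹ : ℝ) : 𝕜) * inner 𝕜 (x i) (x j) := by
    intro i j
    rw [inner_smul_left, inner_smul_right, RCLike.conj_ofReal, RCLike.ofReal_mul, mul_assoc]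
  have hunit : ∀ i, ‖(((√n)⁻¹ : ℝ) : 𝕜) • x i‖ = 1 := by
    intro i
    rw [← pow_left_inj₀ (norm_nonneg _) zero_le_one two_ne_zero, norm_smul, mul_pow, h1,
      RCLike.norm_ofReal, abs_of_nonneg hs0, sq, hsq, one_pow]
  have hangle : ∀ i j, i ≠ j →
      ‖inner 𝕜 ((((√n)⁻¹ : ℝ) : 𝕜) • x i) ((((√n)⁻¹ : ℝ) : 𝕜) • x j)‖ = etfAngle 𝕜 n := by
    intro i j hij
    rw [hinner, norm_mul, h2 i j hij, RCLike.norm_ofReal, abs_of_nonneg (by positivity)]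
    linear_combination etfAngle 𝕜 n * hsq
  refine ⟨⟨fun i j hij => ?_, hunit, etfAngle 𝕜 n, hangle⟩, (n / gerzonBound 𝕜 n : 𝕜), fun y => ?_⟩
  -- Two equal vectors would have inner product 1, whereas t < 1.
  · by_contra hne
    have h4 := hangle i j hne
    simp only at hij
    rw [← hij, inner_self_eq_norm_sq_to_K, hunit] at h4
    simp only [RCLike.ofReal_one, one_pow, norm_one] at h4
    exact (etfAngle_lt_one 𝕜 hn).ne' h4
  · have hd0 : (gerzonBound 𝕜 n : 𝕜) ≠ 0 := by exact_mod_cast (gerzonBound_pos 𝕜 hn).ne'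
    have h4 : ∀ i, inner 𝕜 ((((√n)⁻¹ : ℝ) : 𝕜) • x i) y • (((√n)⁻¹ : ℝ) : 𝕜) • x i =
        (((√n)⁻¹ * (√n)⁻¹ : ℝ) : 𝕜) • inner 𝕜 (x i) y • x i := by
      intro i
      rw [inner_smul_left, RCLike.conj_ofReal, smul_smul, smul_smul, RCLike.ofReal_mul]
      congr 1
      ring
    have hsq' : (((√n)⁻¹ * (√n)⁻¹ : ℝ) : 𝕜) * n = 1 := by
      rw [← RCLike.ofReal_natCast (K := 𝕜) n, ← RCLike.ofReal_mul, hsq, RCLike.ofReal_one]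
    simp only [h4]
    rw [← Finset.smul_sum, h3, smul_smul, smul_smul, div_mul_eq_mul_div, div_mul_eq_mul_div, mul_comm (n : 𝕜), hsq', one_mul,
      div_self hd0, one_smul]

/-- The map T is `dualCoords` in the isotropic basis, scaled by 1/√n to make the frame vectors unit.
The inner inclusion holds because the r i lie in the dual ball; the outer one is
`norm_apply_le_of_extremal` read through `exists_eq_sum_of_norm_le`. -/
theorem exists_isMaximalETF_of_absProjConst_eq [FiniteDimensional 𝕜 X] (hn : 1 ≤ n)
    (hX : Module.finrank 𝕜 X = n) (h : absProjConst 𝕜 X = ENNReal.ofReal (deltaConst 𝕜 n)) :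
    ∃ (w : Fin (gerzonBound 𝕜 n) → EuclideanSpace 𝕜 (Fin n))
      (T : StrongDual 𝕜 X →ₗ[𝕜] EuclideanSpace 𝕜 (Fin n)),
      IsMaximalETF w ∧
      absConvHull 𝕜 (Set.range w) ⊆ T '' Metric.closedBall (0 : StrongDual 𝕜 X) 1 ∧
      T '' Metric.closedBall (0 : StrongDual 𝕜 X) 1 ⊆
        ((n : ℝ) / ((gerzonBound 𝕜 n : ℝ) * deltaConst 𝕜 n)) • zonotope 𝕜 w := by
  obtain ⟨F, e, r, h1, h2, h3, h4, h5⟩ := exists_extremal_functionals hn hX h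
  have hδ := deltaConst_pos 𝕜 hn
  have hn' : (0 : ℝ) < n := by exact_mod_cast hn
  have hd : (0 : ℝ) < gerzonBound 𝕜 n := by exact_mod_cast gerzonBound_pos 𝕜 hn
  have h3' : ∀ s : StrongDual 𝕜 X, ∑ k, inner 𝕜 (dualCoords e (r k : StrongDual 𝕜 X))
      (dualCoords e s) • (r k : StrongDual 𝕜 X) = (gerzonBound 𝕜 n : 𝕜) • s := fun s =>
    dualCoords_injective e (by simpa using h3 (dualCoords e s))
  have hle := norm_apply_le_of_extremal hn (φ := fun s k =>
    inner 𝕜 (dualCoords e (r k : StrongDual 𝕜 X)) (dualCoords e s)) h3' h4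
    (re_apply_smulRight_eq hn h1 h2 h3' h4 h5)
  set T : StrongDual 𝕜 X →ₗ[𝕜] EuclideanSpace 𝕜 (Fin n) :=
    (((√n)⁻¹ : ℝ) : 𝕜) • dualCoords e with hT
  refine ⟨fun i => T (r i), T, isMaximalETF_of_norm_inner_eq hn h1 h2 h3, ?_, ?_⟩
  · rintro _ ⟨N, x, a, hx, ha, rfl⟩
    choose i hi using hx
    refine ⟨∑ j, a j • (r (i j) : StrongDual 𝕜 X), ?_, by simp [← hi]⟩
    rw [mem_closedBall_zero_iff]
    refine (norm_sum_le _ _).trans ((Finset.sum_le_sum fun j _ => ?_).trans ha)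
    rw [norm_smul]
    exact mul_le_of_le_one_right (norm_nonneg _) (r (i j)).norm_le
  · rintro _ ⟨s, hs, rfl⟩
    set M : ℝ := (n : ℝ) / ((gerzonBound 𝕜 n : ℝ) * deltaConst 𝕜 n) with hM
    have hM0 : 0 < M := by positivity
    obtain ⟨a, ha, has⟩ := exists_eq_sum_of_norm_le
      (fun j => ((r j : StrongDual 𝕜 X) : X →ₗ[𝕜] 𝕜)) ((s : StrongDual 𝕜 X) : X →ₗ[𝕜] 𝕜)
      hM0.le (hle ⟨s, hs⟩)
    rw [mem_real_smul_zonotope_iff]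
    refine ⟨fun i => ((M⁻¹ : ℝ) : 𝕜) * a i, fun i => ?_, ?_⟩
    · rw [norm_mul, RCLike.norm_ofReal, abs_of_pos (inv_pos.mpr hM0), inv_mul_le_iff₀ hM0, mul_one]
      exact ha i
    · have h6 : s = ∑ j, a j • (r j : StrongDual 𝕜 X) := by
        ext y
        simpa [sum_apply] using has y
      have hM1 : (M : 𝕜) ≠ 0 := by exact_mod_cast hM0.ne'
      simp only [mul_smul, ← Finset.smul_sum]
      rw [RCLike.ofReal_inv, smul_inv_smul₀ hM1]
      conv_lhs => rw [h6]
      simp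

lemma IsMaximalETF.eq_zero_of_inner_eq_zero
    {w : Fin (gerzonBound 𝕜 n) → EuclideanSpace 𝕜 (Fin n)} (hw : IsMaximalETF w)
    {y : EuclideanSpace 𝕜 (Fin n)} (hy : ∀ i, inner 𝕜 (w i) y = 0) : y = 0 := by
  obtain ⟨-, α, hα⟩ := hw
  rw [hα y]
  simp [hy]

/-- The image of T contains the frame, which spans, so T is bijective by dimension. Both inclusions
then pull back to the dual of X, where the trace bound applies. -/
theorem deltaConst_le_absProjConst_of_subset [FiniteDimensional 𝕜 X] (hn : 1 ≤ n)
    (hX : Module.finrank 𝕜 X = n) {w : Fin (gerzonBound 𝕜 n) → EuclideanSpace 𝕜 (Fin n)}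
    {T : StrongDual 𝕜 X →ₗ[𝕜] EuclideanSpace 𝕜 (Fin n)} (hw : IsMaximalETF w)
    (h1 : absConvHull 𝕜 (Set.range w) ⊆ T '' Metric.closedBall (0 : StrongDual 𝕜 X) 1)
    (h2 : T '' Metric.closedBall (0 : StrongDual 𝕜 X) 1 ⊆
        ((n : ℝ) / ((gerzonBound 𝕜 n : ℝ) * deltaConst 𝕜 n)) • zonotope 𝕜 w) :
    ENNReal.ofReal (deltaConst 𝕜 n) ≤ absProjConst 𝕜 X := by
  have hmem : ∀ i, ∃ ξ : StrongDual 𝕜 X, ‖ξ‖ ≤ 1 ∧ T ξ = w i := by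
    intro i
    obtain ⟨ξ, hξ, hξ'⟩ := h1 (a := w i) ⟨1, fun _ => w i, fun _ => 1, fun _ => ⟨i, rfl⟩, by simp, by simp⟩
    exact ⟨ξ, mem_closedBall_zero_iff.mp hξ, hξ'⟩
  choose ξ hξ hTξ using hmem
  have hsurj : Function.Surjective T := by
    obtain ⟨-, α, hα⟩ := hw
    intro y
    refine ⟨α • ∑ i, inner 𝕜 (w i) y • ξ i, ?_⟩
    conv_rhs => rw [hα y]
    simp [hTξ]
  have hinj : Function.Injective T := by
    refine (LinearMap.injective_iff_surjective_of_finrank_eq_finrank ?_).mpr hsurj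
    rw [finrank_euclideanSpace_fin, ← hX, ← (LinearMap.toContinuousLinearMap :
      (X →ₗ[𝕜] 𝕜) ≃ₗ[𝕜] X →L[𝕜] 𝕜).finrank_eq]
    exact Subspace.dual_finrank_eq
  refine deltaConst_le_absProjConst hn hX hξ fun s hs => ?_
  obtain ⟨a, ha, has⟩ := mem_real_smul_zonotope_iff.mp
    (h2 ⟨s, mem_closedBall_zero_iff.mpr hs, rfl⟩)
  exact ⟨a, ha, hinj (by rw [has]; simp [hTξ])⟩

/-- The witness is 𝕜ⁿ normed by ∑ |⟨w i, y⟩|, realised as a subspace of ℓ¹ of dimension n. Its dual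
ball lies in the zonotope of the coordinate functionals, and their multiples by ρ = dδ/n still have
norm at most 1. -/
theorem deltaConst_le_maxProjConst (hn : 1 ≤ n)
    {w : Fin (gerzonBound 𝕜 n) → EuclideanSpace 𝕜 (Fin n)} (hw : IsMaximalETF w) :
    ENNReal.ofReal (deltaConst 𝕜 n) ≤ maxProjConst.{u} 𝕜 n := by
  have hδ := deltaConst_pos 𝕜 hn
  have hn' : (0 : ℝ) < n := by exact_mod_cast hn
  have hd : (0 : ℝ) < gerzonBound 𝕜 n := by exact_mod_cast gerzonBound_pos 𝕜 hn
  -- The lifted index type only serves to place the space in the universe `u`.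
  let E := PiLp 1 (fun _ : ULift.{u} (Fin (gerzonBound 𝕜 n)) => 𝕜)
  let L : EuclideanSpace 𝕜 (Fin n) →ₗ[𝕜] E :=
    (WithLp.linearEquiv 1 𝕜 (ULift.{u} (Fin (gerzonBound 𝕜 n)) → 𝕜)).symm.toLinearMap ∘ₗ
      LinearMap.pi fun i => (innerSL 𝕜 (w i.down)).toLinearMap
  have hL : ∀ y i, L y i = inner 𝕜 (w i.down) y := fun y i => rfl
  have hinj : Function.Injective L := (injective_iff_map_eq_zero L).mpr fun y hy =>
    hw.eq_zero_of_inner_eq_zero fun i => by rw [← hL y ⟨i⟩, hy]; rfl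
  let X := LinearMap.range L
  have hX : Module.finrank 𝕜 X = n := by
    rw [LinearMap.finrank_range_of_inj hinj, finrank_euclideanSpace_fin]
  have hnorm : ∀ v : E, ‖v‖ = ∑ i, ‖v ⟨i⟩‖ := by
    intro v
    rw [PiLp.norm_eq_of_nat 1 (by simp)]
    simp only [pow_one, Nat.cast_one, div_one, Real.rpow_one]
    exact Fintype.sum_equiv Equiv.ulift _ _ fun i => rfl
  set ρ : ℝ := gerzonBound 𝕜 n * deltaConst 𝕜 n / n with hρ
  have hρ0 : 0 < ρ := by positivity
  let c : Fin (gerzonBound 𝕜 n) → StrongDual 𝕜 X := fun i =>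
    (PiLp.proj 1 (fun _ : ULift.{u} (Fin (gerzonBound 𝕜 n)) => 𝕜) ⟨i⟩).comp X.subtypeL
  have hc : ∀ i (v : X), c i v = (v : E) ⟨i⟩ := fun i v => rfl
  have hle : ENNReal.ofReal (deltaConst 𝕜 n) ≤ absProjConst 𝕜 X := by
    refine deltaConst_le_absProjConst hn hX (ξ := fun i => (ρ : 𝕜) • c i) (fun i => ?_)
      fun s hs => ?_
    · refine ContinuousLinearMap.opNorm_le_bound _ zero_le_one ?_
      rintro ⟨_, y, rfl⟩
      rw [one_mul, Submodule.coe_norm, hnorm, smul_apply, norm_smul, RCLike.norm_ofReal,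
        abs_of_pos hρ0]
      exact hw.mul_norm_inner_le hn i y
    · obtain ⟨a, ha, has⟩ := exists_eq_sum_of_norm_le (fun j => (c j : X →ₗ[𝕜] 𝕜))
        (s : X →ₗ[𝕜] 𝕜) zero_le_one fun v => by
          simp only [ContinuousLinearMap.coe_coe, hc, ← hnorm]
          exact s.le_of_opNorm_le hs v
      refine ⟨a, ha, ?_⟩
      have hρ1 : (ρ : 𝕜) ≠ 0 := by exact_mod_cast hρ0.ne'
      have h1 : (n / (gerzonBound 𝕜 n * deltaConst 𝕜 n) : ℝ) = ρ⁻¹ := by rw [hρ, inv_div]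
      simp only [smul_comm (a _) (ρ : 𝕜), ← Finset.smul_sum]
      rw [h1, RCLike.ofReal_inv, inv_smul_smul₀ hρ1]
      ext v
      simpa [sum_apply] using has v
  exact hle.trans (le_iSup_of_le X (le_iSup_of_le inferInstance (le_iSup_of_le inferInstance
    (le_iSup_of_le inferInstance (le_iSup_of_le hX le_rfl)))))

end Characterization

end

theorem theorem2 {𝕜 : Type} [RCLike 𝕜] (n : ℕ) (hn : 1 ≤ n)
    (hETF : ∃ w : Fin (gerzonBound 𝕜 n) → EuclideanSpace 𝕜 (Fin n), IsMaximalETF w) :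
    maxProjConst.{u} 𝕜 n = ENNReal.ofReal (deltaConst 𝕜 n) ∧
    ∀ (X : Type u) [NormedAddCommGroup X] [NormedSpace 𝕜 X] [FiniteDimensional 𝕜 X],
      Module.finrank 𝕜 X = n →
      (absProjConst 𝕜 X = maxProjConst.{u} 𝕜 n ↔
        ∃ (w : Fin (gerzonBound 𝕜 n) → EuclideanSpace 𝕜 (Fin n))
          (T : StrongDual 𝕜 X →ₗ[𝕜] EuclideanSpace 𝕜 (Fin n)),
          IsMaximalETF w ∧
          absConvHull 𝕜 (Set.range w) ⊆ T '' Metric.closedBall (0 : StrongDual 𝕜 X) 1 ∧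
          T '' Metric.closedBall (0 : StrongDual 𝕜 X) 1 ⊆
            ((n : ℝ) / ((gerzonBound 𝕜 n : ℝ) * deltaConst 𝕜 n)) • zonotope 𝕜 w) := by
  obtain ⟨w₀, hw₀⟩ := hETF
  have hmax : maxProjConst.{u} 𝕜 n = ENNReal.ofReal (deltaConst 𝕜 n) :=
    le_antisymm (iSup_le fun X => iSup_le fun _ => iSup_le fun _ => iSup_le fun _ =>
      iSup_le fun hX => absProjConst_le hn hX) (deltaConst_le_maxProjConst hn hw₀)
  refine ⟨hmax, fun X _ _ _ hX => ?_⟩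
  rw [hmax]
  refine ⟨exists_isMaximalETF_of_absProjConst_eq hn hX, ?_⟩
  rintro ⟨w, T, hw, h1, h2⟩
  exact le_antisymm (absProjConst_le hn hX)
    (deltaConst_le_absProjConst_of_subset hn hX hw h1 h2)
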